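/- Let $Z$ be a real random variable with distribution function $P(x)=\mathbb P(Z\le x)$, and let $-\infty\le p_-<0<p_+\le+\infty$ be such that the characteristic function $u\mapsto\mathbb E[e^{iuZ}]$, $u\in\mathbb R$, extends to an analytic function $\phi_Z$ on the strip $\{z\in\mathbb C: p_-<\operatorname{Im}z<p_+\}$ (for instance, the largest such strip). Let $a\in\left(\tfrac12p_-,\tfrac12p_+\right)\setminus\{0\}$, and put $R_a=0$ if $a>0$ and $R_a=1$ if $a<0$. For an integer $N\ge1$ and a step $h>0$ let $u_n=(n+\tfrac12)h$ and let $$\hat P(x)=R_a-\frac{h\,e^{ax}}{\pi}\,\operatorname{Re}\sum_{n=0}^{N-1}\frac{\phi_Z(u_n+ia)}{i(u_n+ia)}\,e^{-iu_nx},\qquad x\in\mathbb R,$$ be the midpoint-rule (FFT) approximation of the shifted inversion formula $P(x)=R_a-\frac{e^{ax}}{\pi}\int_0^\infty\operatorname{Re}\left(\frac{e^{-iux}\phi_Z(u+ia)}{i(u+ia)}\right)du$. Then $\phi_Z(2ia)$ is real and the following hold. (i) (Exponential decay.) If $B,\ell,\omega>0$ and $U\in\mathbb R$ are such that $|\phi_Z(u+ia)|<Be^{-\ell|u|^\omega}$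 for all real $u$ with $|u|\ge U$, then for all $N\ge1$ and $h>0$ with $Nh\ge U$ and all $x\in\mathbb R$, $$|P(x)-\hat P(x)|\le\frac{Be^{ax}}{\pi\omega}\,\frac{e^{-\ell(Nh)^\omega}}{\ell(Nh)^\omega}+\frac{1+e^{2ax}\phi_Z(2ia)}{e^{2\pi|a|/h}-e^{-2\pi|a|/h}}.$$ (ii) (Power-law decay.) If $B,\omega>0$ and $U\in\mathbb R$ are such that $|\phi_Z(u+ia)|<B|u|^{-\omega}$ for all real $u$ with $|u|\ge U$, $u\neq 0$, then for all $N\ge1$ and $h>0$ with $Nh\ge U$ and all $x\in\mathbb R$, $$|P(x)-\hat P(x)|\le\frac{Be^{ax}}{\pi\omega}\,(Nh)^{-\omega}+\frac{1+e^{2ax}\phi_Z(2ia)}{e^{2\pi|a|/h}-e^{-2\pi|a|/h}}.$$ -/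

import Mathlib

open MeasureTheory

noncomputable section

/-- The horizontal strip `pₗ < Im z < pᵤ` of the complex plane; the bounds may be infinite. -/
def horizontalStrip (pₗ pᵤ : EReal) : Set ℂ :=
  {z | pₗ < (z.im : EReal) ∧ (z.im : EReal) < pᵤ}

/-- `(pₗ, pᵤ)` is a strip of analyticity, containing the origin, of the characteristic function of
the law `μ`, and `φ` is the characteristic function at complex arguments of this strip: it is
analytic there and agrees with `u ↦ ∫ exp (i u x) dμ(x)` on the real line. By the identity theorem
`φ` is determined by `μ` on the strip. The maximal strip of analyticity is a special case. -/
structure IsCharFunOnStrip (μ : Measure ℝ) (pₗ pᵤ : EReal) (φ : ℂ → ℂ) : Prop where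
  neg : pₗ < 0
  pos : 0 < pᵤ
  analytic : AnalyticOnNhd ℂ φ (horizontalStrip pₗ pᵤ)
  eq_charFun : ∀ u : ℝ, φ (u : ℂ) = charFun μ u

/-- Exponential decay of `φ` along the line `Im z = a`, valid from the threshold `U` on. -/
def ExponentialDecay (φ : ℂ → ℂ) (a B l ω U : ℝ) : Prop :=
  ∀ u : ℝ, U ≤ |u| → ‖φ ((u : ℂ) + Complex.I * (a : ℂ))‖ < B * Real.exp (-l * |u| ^ ω)

/-- Power-law decay of `φ` along the line `Im z = a`, valid from the threshold `U` on. -/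
def PowerLawDecay (φ : ℂ → ℂ) (a B ω U : ℝ) : Prop :=
  ∀ u : ℝ, u ≠ 0 → U ≤ |u| → ‖φ ((u : ℂ) + Complex.I * (a : ℂ))‖ < B * |u| ^ (-ω)

/-- The constant `R_a` of the shifted inversion formula (used for `a ≠ 0`). -/
def residueTerm (a : ℝ) : ℝ := if 0 < a then 0 else 1

/-- The nodes `(n + 1/2) h` of the midpoint rule. -/
def midpointNode (h : ℝ) (n : ℕ) : ℝ := ((n : ℝ) + 1 / 2) * h

/-- The approximation of the distribution function: the midpoint rule with `N` nodes and step `h`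
for the shifted inversion formula
`P x = R_a - (exp (a x) / π) ∫₀^∞ Re (exp (-i u x) φ (u + i a) / (i (u + i a))) du`. -/
def cdfApprox (φ : ℂ → ℂ) (a h : ℝ) (N : ℕ) (x : ℝ) : ℝ :=
  residueTerm a - h * Real.exp (a * x) / Real.pi *
    (∑ n ∈ Finset.range N,
      φ ((midpointNode h n : ℂ) + Complex.I * (a : ℂ)) /
          (Complex.I * ((midpointNode h n : ℂ) + Complex.I * (a : ℂ))) *
        Complex.exp (-(Complex.I * (x : ℂ) * (midpointNode h n : ℂ)))).re

/-- The bound for the discretisation error. -/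
def discretisationBound (φ : ℂ → ℂ) (a h x : ℝ) : ℝ :=
  1 / (Real.exp (2 * Real.pi * |a| / h) - Real.exp (-(2 * Real.pi * |a| / h))) *
    (1 + Real.exp (2 * a * x) * (φ (2 * Complex.I * (a : ℂ))).re)

end

section

open Filter Topology ProbabilityTheory Complex FourierTransform

/-! Put Q = P - R_a. The constant R_a is chosen so that e^{-ay} Q(y) decays at both ends; its
transform ∫ e^{-(a-iu)y} Q(y) dy is φ_Z(u+ia)/(a-iu). Poisson summation with frequencies displaced
by half a step turns the midpoint sum with infinitely many nodes into Σ_k (-1)^k e^{-akT} Q(x+kT), T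
= 2π/h. The term k = 0 is Q(x), so the error is exactly the tail of the midpoint sum beyond N minus
the aliasing terms k ≠ 0.

Aliasing (`abs_tsum_alternating_shiftedCdf_sub_le`): Q has constant sign, |Q| ≤ 1, and |Q(y)| ≤
e^{2ay} φ_Z(2ia) by an exponential Chebyshev bound. Pairing k with -k gives terms below (1 + e^{2ax}
φ_Z(2ia)) q^k, q = e^{-|a|T}. Even and odd k contribute with opposite signs, so only one half of the
geometric series counts, which yields q/(1-q²).

Tail: the midpoint rule underestimates integrals of convex functions, which handles power decay and
exponential decay with ω ≤ 1; for ω ≥ 1 Bernoulli's inequality gives a geometric majorant.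

Two preliminaries. The function φ is only an analytic continuation, so finiteness of the exponential
moments must be proved (`IsCharFunOnStrip.eq_complexMGF`). Poisson summation needs P continuous,
which follows from Fourier inversion and the decay hypothesis (`continuous_shiftedCdf`). -/

/-! ### Exponential moments from analyticity of the characteristic function -/

/-- Central differences of order `2 n` of the characteristic function. -/
theorem sum_choose_mul_integral_exp (ν : Measure ℝ) [IsFiniteMeasure ν] (n : ℕ) (u : ℝ) :
    ∑ k ∈ Finset.range (2 * n + 1), ((-1 : ℂ) ^ (2 * n - k) * ((2 * n).choose k : ℂ)) *
      ∫ x, cexp (((-n + k : ℂ) * u) * x * I) ∂ν =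
    (-1) ^ n * ((∫ x, (2 * Real.sin (u * x / 2)) ^ (2 * n) ∂ν : ℝ) : ℂ) := by
  have hint : ∀ k : ℕ, Integrable (fun x : ℝ ↦ cexp (((-n + k : ℂ) * u) * x * I)) ν := by
    intro k
    refine (integrable_const (1 : ℝ)).mono' (by fun_prop) (ae_of_all _ fun x ↦ ?_)
    have : ((-n + k : ℂ) * u) * x * I = (((-n + k : ℝ) * u * x : ℝ) : ℂ) * I := by push_cast; ring
    rw [this, norm_exp_ofReal_mul_I]
  rw [← integral_complex_ofReal, ← integral_const_mul]
  simp_rw [← integral_const_mul]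
  rw [← integral_finsetSum _ fun k _ ↦ (hint k).const_mul _]
  congr 1 with x
  -- With this half-angle exponential the sum is the binomial expansion of (e² - 1)^{2n} / e^{2n}.
  set e : ℂ := cexp (u * x / 2 * I)
  have he : e ≠ 0 := exp_ne_zero _
  have hterm : ∀ k : ℕ, cexp (((-n + k : ℂ) * u) * x * I) = (e ^ (2 * n))⁻¹ * (e ^ 2) ^ k := by
    intro k
    simp only [e, ← Complex.exp_nat_mul, ← Complex.exp_neg, ← Complex.exp_add]
    congr 1
    push_cast; ring
  have hsin : ((2 * Real.sin (u * x / 2) : ℝ) : ℂ) = I * (e⁻¹ - e) := by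
    simp only [e, ← Complex.exp_neg]
    push_cast
    rw [Complex.sin]
    ring_nf
  have hpow : ((((2 * Real.sin (u * x / 2)) ^ (2 * n) : ℝ)) : ℂ) =
      (-1) ^ n * ((e ^ (2 * n))⁻¹ * (e ^ 2 + -1) ^ (2 * n)) := by
    rw [ofReal_pow, hsin, mul_pow, pow_mul I, I_sq, ← inv_pow, ← mul_pow]
    congr 1
    rw [pow_mul, pow_mul]
    congr 1
    field_simp
    ring
  rw [hpow, ← mul_assoc, ← pow_add, ← two_mul, pow_mul (-1 : ℂ) 2 n, add_pow, Finset.mul_sum]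
  simp only [even_two, Even.neg_pow, one_pow, one_mul]
  refine Finset.sum_congr rfl fun k _ ↦ ?_
  rw [hterm]
  ring

/-- The m-th difference annihilates the powers below m and sends the m-th power to m!, so only the
m-th Taylor coefficient survives; the Taylor remainder is O(t^{m+1}) at each node. -/
theorem tendsto_central_difference {φ : ℂ → ℂ} {p : FormalMultilinearSeries ℂ ℂ ℂ}
    (hp : HasFPowerSeriesAt φ p 0) (m : ℕ) (b : ℂ) {t : ℕ → ℂ}
    (ht : Tendsto t atTop (𝓝 0)) (ht0 : ∀ j, t j ≠ 0) :
    Tendsto (fun j ↦ (∑ k ∈ Finset.range (m + 1), ((-1 : ℂ) ^ (m - k) * (m.choose k : ℂ)) *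
      φ ((b + k) * t j)) / t j ^ m) atTop (𝓝 (m.factorial * p.coeff m)) := by
  have hO := hp.isBigO_sub_partialSum_pow (m + 1)
  have hterm : ∀ k : ℕ, Tendsto (fun j ↦ (φ ((b + k) * t j) -
      p.partialSum (m + 1) ((b + k) * t j)) / t j ^ m) atTop (𝓝 0) := by
    intro k
    have h0 : Tendsto (fun j ↦ (b + k) * t j) atTop (𝓝 0) := by
      simpa using ht.const_mul (b + k)
    have h1 := hO.comp_tendsto h0
    have h2 : (fun j ↦ φ ((b + k) * t j) - p.partialSum (m + 1) ((b + k) * t j)) =O[atTop]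
        fun j ↦ (t j) ^ (m + 1) := by
      refine Asymptotics.IsBigO.trans (by simpa [Function.comp_def] using h1) ?_
      refine Asymptotics.IsBigO.of_bound (‖b + k‖ ^ (m + 1)) (Eventually.of_forall fun j ↦ ?_)
      simp [mul_pow]
    have h3 : (fun j ↦ (φ ((b + k) * t j) - p.partialSum (m + 1) ((b + k) * t j)) / t j ^ m)
        =O[atTop] t := by
      have := h2.mul (Asymptotics.isBigO_refl (fun j ↦ (t j ^ m)⁻¹) atTop)
      refine this.congr_right fun j ↦ ?_
      rw [pow_succ]
      have := ht0 j
      field_simp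
    exact h3.trans_tendsto ht
  have hsum := tendsto_finsetSum (Finset.range (m + 1)) fun k _ ↦
    (hterm k).const_mul ((-1 : ℂ) ^ (m - k) * (m.choose k : ℂ))
  simp only [mul_zero, Finset.sum_const_zero] at hsum
  have hpoly : ∀ j, (∑ k ∈ Finset.range (m + 1), ((-1 : ℂ) ^ (m - k) * (m.choose k : ℂ)) *
      p.partialSum (m + 1) ((b + k) * t j)) = m.factorial * p.coeff m * t j ^ m := by
    intro j
    have hd : ∀ i : ℕ, (∑ k ∈ Finset.range (m + 1), ((-1 : ℂ) ^ (m - k) * (m.choose k : ℂ)) *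
        (b + k) ^ i) = (fwdDiff (1 : ℂ))^[m] (fun r ↦ r ^ i) b := by
      intro i
      rw [fwdDiff_iter_eq_sum_shift]
      refine Finset.sum_congr rfl fun k _ ↦ ?_
      simp
    simp only [FormalMultilinearSeries.partialSum, FormalMultilinearSeries.apply_eq_pow_smul_coeff,
      smul_eq_mul, mul_pow, Finset.mul_sum]
    rw [Finset.sum_comm]
    have : ∀ i ∈ Finset.range (m + 1), (∑ k ∈ Finset.range (m + 1),
        ((-1 : ℂ) ^ (m - k) * (m.choose k : ℂ)) * ((b + k) ^ i * t j ^ i * p.coeff i)) =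
        (fwdDiff (1 : ℂ))^[m] (fun r ↦ r ^ i) b * (t j ^ i * p.coeff i) := by
      intro i _
      rw [← hd, Finset.sum_mul]
      exact Finset.sum_congr rfl fun k _ ↦ by ring
    rw [Finset.sum_congr rfl this, Finset.sum_range_succ, Finset.sum_eq_zero, fwdDiff_iter_eq_factorial]
    · simp; ring
    · intro i hi
      rw [fwdDiff_iter_pow_eq_zero_of_lt (Finset.mem_range.1 hi)]
      simp
  have := hsum.add_const ((m.factorial : ℂ) * p.coeff m)
  rw [zero_add] at this
  refine this.congr fun j ↦ ?_
  have hj : t j ^ m ≠ 0 := pow_ne_zero _ (ht0 j)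
  rw [eq_div_iff hj, add_mul, ← hpoly j, Finset.sum_mul, ← Finset.sum_add_distrib]
  refine Finset.sum_congr rfl fun k _ ↦ ?_
  field_simp
  ring

/-- Even moments are bounded by the Taylor coefficients of the characteristic function. -/
theorem lintegral_pow_le_of_hasFPowerSeriesAt (ν : Measure ℝ) [IsFiniteMeasure ν] {φ : ℂ → ℂ}
    {p : FormalMultilinearSeries ℂ ℂ ℂ} (hp : HasFPowerSeriesAt φ p 0)
    (hφ : ∀ u : ℝ, φ u = charFun ν u) (n : ℕ) :
    ∫⁻ x, ENNReal.ofReal (x ^ (2 * n)) ∂ν ≤ ENNReal.ofReal ((2 * n).factorial * ‖p.coeff (2 * n)‖) := by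
  set t : ℕ → ℝ := fun j ↦ 1 / ((j : ℝ) + 1)
  have ht : Tendsto t atTop (𝓝 0) := tendsto_one_div_add_atTop_nhds_zero_nat
  have ht0 : ∀ j, 0 < t j := fun j ↦ by positivity
  have h1 := (tendsto_central_difference hp (2 * n) (-n) (t := fun j ↦ (t j : ℂ))
    (by exact_mod_cast (continuous_ofReal.tendsto 0).comp ht)
    (fun j ↦ by exact_mod_cast (ht0 j).ne')).norm
  set g : ℕ → ℝ → ℝ := fun j x ↦ (2 * Real.sin (t j * x / 2) / t j) ^ (2 * n)
  have hg0 : ∀ j x, 0 ≤ g j x := fun j x ↦ Even.pow_nonneg (even_two_mul n) _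
  have hgm : ∀ j, Measurable (g j) := fun j ↦ by fun_prop
  have hgi : ∀ j, Integrable (g j) ν := by
    intro j
    refine (integrable_const ((2 / t j) ^ (2 * n))).mono' (hgm j).aestronglyMeasurable
      (ae_of_all _ fun x ↦ ?_)
    simp only [g, norm_pow, norm_div, norm_mul, Real.norm_eq_abs, abs_of_pos (ht0 j)]
    have := Real.abs_sin_le_one (t j * x / 2)
    have := ht0 j
    gcongr
    simp only [Nat.abs_ofNat]; linarith
  have hint : ∀ j, ∫⁻ x, ENNReal.ofReal (g j x) ∂ν = ENNReal.ofReal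
      ‖(∑ k ∈ Finset.range (2 * n + 1), ((-1 : ℂ) ^ (2 * n - k) * ((2 * n).choose k : ℂ)) *
      φ ((-n + k) * t j)) / t j ^ (2 * n)‖ := by
    intro j
    rw [← ofReal_integral_eq_lintegral_ofReal (hgi j) (ae_of_all _ (hg0 j))]
    congr 1
    have h2 := sum_choose_mul_integral_exp ν n (t j)
    have h3 : ∀ k : ℕ, φ ((-n + k) * t j) = ∫ x, cexp (((-n + k : ℂ) * t j) * x * I) ∂ν := by
      intro k
      have := hφ ((-n + k) * t j)
      rw [charFun_apply_real] at this
      push_cast at this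
      rw [this]
    simp_rw [h3]
    rw [h2, norm_div, norm_mul, norm_pow, norm_neg, norm_one, one_pow, one_mul, norm_real, norm_pow,
      norm_real, Real.norm_of_nonneg (ht0 j).le, Real.norm_of_nonneg
        (integral_nonneg fun x ↦ Even.pow_nonneg (even_two_mul n) _), ← integral_div]
    simp only [g, div_pow]
  have hlim : ∀ x, Tendsto (fun j ↦ ENNReal.ofReal (g j x)) atTop
      (𝓝 (ENNReal.ofReal (x ^ (2 * n)))) := by
    intro x
    refine (ENNReal.continuous_ofReal.tendsto _).comp (Tendsto.pow ?_ _)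
    have hd : HasDerivAt (fun s : ℝ ↦ 2 * Real.sin (s * x / 2)) x 0 := by
      have := ((((hasDerivAt_id (0 : ℝ)).mul_const x).div_const 2).sin).const_mul 2
      convert! this using 1
      simp only [id_eq, zero_mul, zero_div, Real.cos_zero]
      ring
    have := hd.tendsto_slope.comp (tendsto_nhdsWithin_iff.2 ⟨ht, Eventually.of_forall
      fun j ↦ (ht0 j).ne'⟩)
    refine this.congr fun j ↦ ?_
    simp [slope_def_field]
  -- Fatou's lemma: no moment is known to be finite beforehand, and the difference quotients
  -- converge pointwise to x^{2n}.
  calc ∫⁻ x, ENNReal.ofReal (x ^ (2 * n)) ∂ν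
      = ∫⁻ x, liminf (fun j ↦ ENNReal.ofReal (g j x)) atTop ∂ν := by
        simp_rw [fun x ↦ (hlim x).liminf_eq]
    _ ≤ liminf (fun j ↦ ∫⁻ x, ENNReal.ofReal (g j x) ∂ν) atTop :=
        lintegral_liminf_le fun j ↦ (hgm j).ennreal_ofReal
    _ = _ := by
        simp_rw [hint]
        refine Tendsto.liminf_eq ((ENNReal.continuous_ofReal.tendsto _).comp ?_)
        simpa using h1

/-- The series of cosh involves even moments only, and its factor 1/(2n)! cancels the (2n)! in the
moment bound, leaving Σ ‖p_{2n}‖ s^{2n}, finite inside the radius of convergence. -/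
theorem integrable_cosh_of_hasFPowerSeriesOnBall (ν : Measure ℝ) [IsFiniteMeasure ν] {φ : ℂ → ℂ}
    {p : FormalMultilinearSeries ℂ ℂ ℂ} {r : ENNReal} (hp : HasFPowerSeriesOnBall φ p 0 r)
    (hφ : ∀ u : ℝ, φ u = charFun ν u) {s : NNReal} (hs : (s : ENNReal) < r) :
    Integrable (fun x : ℝ ↦ Real.cosh (s * x)) ν := by
  refine ⟨by fun_prop, ?_⟩
  rw [hasFiniteIntegral_iff_ofReal (ae_of_all _ fun x ↦ (Real.cosh_pos _).le)]
  have hsum : Summable fun n : ℕ ↦ ‖p (2 * n)‖ * (s : ℝ) ^ (2 * n) :=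
    (p.summable_norm_mul_pow (hs.trans_le hp.r_le)).comp_injective
      (i := fun n ↦ 2 * n) (fun a b h ↦ by simpa using h)
  have hterm0 : ∀ (x : ℝ) (n : ℕ), 0 ≤ (s * x) ^ (2 * n) / ((2 * n).factorial : ℝ) := fun x n ↦
    div_nonneg (Even.pow_nonneg (even_two_mul n) _) (by positivity)
  have hcosh : ∀ x : ℝ, ENNReal.ofReal (Real.cosh (s * x)) =
      ∑' n : ℕ, ENNReal.ofReal ((s * x) ^ (2 * n) / ((2 * n).factorial : ℝ)) := by
    intro x
    rw [← ENNReal.ofReal_tsum_of_nonneg (hterm0 x) (Real.hasSum_cosh _).summable,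
      (Real.hasSum_cosh _).tsum_eq]
  simp_rw [hcosh]
  rw [lintegral_tsum fun n ↦ by fun_prop]
  refine lt_of_le_of_lt (ENNReal.tsum_le_tsum (g := fun n ↦
    ENNReal.ofReal (‖p (2 * n)‖ * (s : ℝ) ^ (2 * n))) fun n ↦ ?_) ?_
  · have : ∀ x : ℝ, ENNReal.ofReal ((s * x) ^ (2 * n) / ((2 * n).factorial : ℝ)) =
        ENNReal.ofReal ((s : ℝ) ^ (2 * n) / ((2 * n).factorial : ℝ)) * ENNReal.ofReal (x ^ (2 * n)) := by
      intro x
      rw [← ENNReal.ofReal_mul (by positivity), mul_pow]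
      ring_nf
    simp_rw [this]
    rw [lintegral_const_mul _ (by fun_prop)]
    calc _ ≤ _ := mul_le_mul_right
          (lintegral_pow_le_of_hasFPowerSeriesAt ν hp.hasFPowerSeriesAt hφ n) _
      _ = _ := by
        rw [← ENNReal.ofReal_mul (by positivity), ← FormalMultilinearSeries.norm_apply_eq_norm_coef]
        congr 1
        field_simp
  · rw [← ENNReal.ofReal_tsum_of_nonneg (fun n ↦ by positivity) hsum]
    exact ENNReal.ofReal_lt_top

/-- Exponential tilting by e^{cx} moves the centre c to 0: u ↦ G(c + iu) is the characteristic
function of the tilted measure, and e^{(t-c)x} ≤ 2 cosh(qx) for |t - c| < q. -/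
theorem integrable_exp_of_analytic_ball (μ : Measure ℝ) [IsFiniteMeasure μ] {G : ℂ → ℂ}
    {c r : ℝ} (hG : DifferentiableOn ℂ G (Metric.ball (c : ℂ) r))
    (hc : c ∈ integrableExpSet id μ) (hGc : Set.EqOn G (complexMGF id μ) {z | z.re = c})
    {t : ℝ} (ht : |t - c| < r) : t ∈ integrableExpSet id μ := by
  obtain ⟨s, hs, hsr⟩ := exists_between ht
  have hs0 : 0 < s := (abs_nonneg _).trans_lt hs
  lift s to NNReal using hs0.le
  set ν : Measure ℝ := μ.withDensity fun x ↦ ENNReal.ofReal (Real.exp (c * x))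
  have hc' : Integrable (fun x : ℝ ↦ Real.exp (c * x)) μ := hc
  have : IsFiniteMeasure ν := isFiniteMeasure_withDensity_ofReal hc'.2
  have hνi : ∀ f : ℝ → ℂ, ∫ x, f x ∂ν = ∫ x, Real.exp (c * x) • f x ∂μ := by
    intro f
    rw [integral_withDensity_eq_integral_toReal_smul (by fun_prop)
      (ae_of_all _ fun x ↦ ENNReal.ofReal_lt_top)]
    simp_rw [ENNReal.toReal_ofReal (Real.exp_pos _).le]
  have hchar : ∀ u : ℝ, G (c + I * (u : ℂ)) = charFun ν u := by
    intro u
    rw [hGc (by simp), charFun_apply_real, hνi, complexMGF]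
    congr 1 with x
    rw [real_smul, ofReal_exp, ← Complex.exp_add]
    congr 1
    simp only [id]
    push_cast; ring
  have hdiff : DifferentiableOn ℂ (fun w ↦ G (c + I * w)) (Metric.closedBall 0 s) := by
    refine hG.comp (by fun_prop) fun w hw ↦ ?_
    simp only [Metric.mem_closedBall, dist_zero_right] at hw
    simp only [Metric.mem_ball, dist_eq, add_sub_cancel_left, norm_mul, norm_I, one_mul]
    linarith
  have hps := hdiff.hasFPowerSeriesOnBall (by exact_mod_cast hs0)
  obtain ⟨q, hq, hqs⟩ := exists_between hs
  have hq0 : 0 ≤ q := (abs_nonneg _).trans hq.le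
  lift q to NNReal using hq0
  have hcosh := integrable_cosh_of_hasFPowerSeriesOnBall ν hps hchar
    (s := q) (by exact_mod_cast hqs)
  have hexp : Integrable (fun x : ℝ ↦ Real.exp ((t - c) * x)) ν := by
    refine (hcosh.const_mul 2).mono' (by fun_prop) (ae_of_all _ fun x ↦ ?_)
    rw [Real.norm_of_nonneg (Real.exp_pos _).le, Real.cosh_eq, mul_div_cancel₀ _ two_ne_zero]
    have h1 : (t - c) * x ≤ q * |x| := calc
      _ ≤ |(t - c) * x| := le_abs_self _
      _ = |t - c| * |x| := abs_mul _ _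
      _ ≤ q * |x| := by gcongr
    refine (Real.exp_le_exp.2 h1).trans ?_
    rcases abs_choice x with h | h <;> rw [h]
    · linarith [Real.exp_pos (-(q * x))]
    · rw [mul_neg]; linarith [Real.exp_pos (q * x)]
  have := (integrable_withDensity_iff_integrable_smul' (by fun_prop)
      (ae_of_all _ fun x ↦ ENNReal.ofReal_lt_top)).1 hexp
  change Integrable (fun x ↦ Real.exp (t * x)) μ
  refine this.congr (ae_of_all _ fun x ↦ ?_)
  simp only [ENNReal.toReal_ofReal (Real.exp_pos _).le, smul_eq_mul, ← Real.exp_add]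
  congr 1; ring

theorem eqOn_complexMGF_of_analytic_strip (μ : Measure ℝ) [IsFiniteMeasure μ] {G : ℂ → ℂ}
    {c r : ℝ} (hr : 0 < r) (hG : AnalyticOnNhd ℂ G {z | z.re ∈ Set.Ioo (c - r) (c + r)})
    (hc : c ∈ integrableExpSet id μ) (hGc : Set.EqOn G (complexMGF id μ) {z | z.re = c}) :
    Set.Ioo (c - r) (c + r) ⊆ integrableExpSet id μ ∧
      Set.EqOn G (complexMGF id μ) {z | z.re ∈ Set.Ioo (c - r) (c + r)} := by
  have hsub : Set.Ioo (c - r) (c + r) ⊆ integrableExpSet id μ := by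
    intro t ht
    refine integrable_exp_of_analytic_ball μ (hG.differentiableOn.mono fun z hz ↦ ?_) hc hGc
      (t := t) (r := r) ?_
    · have h1 : |(z - c).re| < r := (abs_re_le_norm _).trans_lt (by simpa [dist_eq] using hz)
      rw [sub_re, ofReal_re, abs_lt] at h1
      constructor <;> linarith
    · rw [abs_lt]; constructor <;> linarith [ht.1, ht.2]
  refine ⟨hsub, ?_⟩
  have hint : Set.Ioo (c - r) (c + r) ⊆ interior (integrableExpSet id μ) :=
    interior_maximal hsub isOpen_Ioo
  have hmem : (c : ℂ) ∈ {z : ℂ | z.re ∈ Set.Ioo (c - r) (c + r)} := by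
    simp [hr]
  refine hG.eqOn_of_preconnected_of_frequently_eq
    (analyticOnNhd_complexMGF.mono fun z hz ↦ hint hz) ?_ hmem ?_
  · exact ((convex_Ioo (𝕜 := ℝ) (c - r) (c + r)).linear_preimage reLm).isPreconnected
  -- Identity theorem: these points of the line Re z = c accumulate at c.
  · have ht : Tendsto (fun j : ℕ ↦ (c : ℂ) + (1 / ((j : ℝ) + 1) : ℝ) * I) atTop (𝓝[≠] (c : ℂ)) := by
      refine tendsto_nhdsWithin_iff.2 ⟨?_, Eventually.of_forall fun j ↦ ?_⟩
      · have h0 := (continuous_ofReal.tendsto 0).comp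
          (tendsto_one_div_add_atTop_nhds_zero_nat (𝕜 := ℝ))
        simpa using (h0.mul_const I).const_add (c : ℂ)
      · simp only [Set.mem_compl_iff, Set.mem_singleton_iff, add_eq_left, mul_eq_zero, I_ne_zero,
          or_false, ofReal_eq_zero]
        positivity
    refine ht.frequently (Frequently.of_forall fun j ↦ hGc ?_)
    simp

/-- If the moment generating function of a finite measure extends analytically from the imaginary
axis to a vertical strip, then the exponential moments in this strip are finite and the extension
is given by the integral. -/
theorem eqOn_complexMGF_of_analyticOnNhd (μ : Measure ℝ) [IsFiniteMeasure μ] {G : ℂ → ℂ}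
    {α β : ℝ} (hα : α < 0) (hβ : 0 < β) (hG : AnalyticOnNhd ℂ G {z | z.re ∈ Set.Ioo α β})
    (hG0 : ∀ u : ℝ, G (u * I) = charFun μ u) {t : ℝ} (ht : t ∈ Set.Ioo α β) :
    t ∈ integrableExpSet id μ ∧ Set.EqOn G (complexMGF id μ) {z | z.re = t} := by
  -- One radius that fits in (α, β) around every point between 0 and t. A single disc about 0 need
  -- not reach t, so the continuation proceeds in n steps of length |t|/n < r.
  obtain ⟨r, hr, hrα, hrβ⟩ : ∃ r : ℝ, 0 < r ∧ α ≤ min 0 t - r ∧ max 0 t + r ≤ β :=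
    ⟨min (min 0 t - α) (β - max 0 t), by
      simp only [lt_min_iff, sub_pos, max_lt_iff]; exact ⟨⟨hα, ht.1⟩, hβ, ht.2⟩,
      by linarith [min_le_left (min 0 t - α) (β - max 0 t)],
      by linarith [min_le_right (min 0 t - α) (β - max 0 t)]⟩
  obtain ⟨n, hn⟩ := exists_nat_gt (|t| / r)
  have hn0 : (0 : ℝ) < n := (by positivity : (0 : ℝ) ≤ |t| / r).trans_lt hn
  have hstep : |t / n| < r := by
    rw [abs_div, Nat.abs_cast, div_lt_iff₀ hn0, mul_comm]
    rwa [div_lt_iff₀ hr] at hn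
  have key : ∀ k : ℕ, k ≤ n → (k * (t / n) ∈ integrableExpSet id μ ∧
      Set.EqOn G (complexMGF id μ) {z | z.re = k * (t / n)}) := by
    intro k
    induction k with
    | zero =>
      intro _
      refine ⟨by simp [integrableExpSet], fun z hz ↦ ?_⟩
      have hz0 : z.re = 0 := by simpa using hz
      have : z = (z.im : ℂ) * I := by apply Complex.ext <;> simp [hz0]
      rw [this, complexMGF_id_mul_I, hG0]
    | succ k ih =>
      intro hk
      obtain ⟨h1, h2⟩ := ih (by omega)
      have hkn : (k : ℝ) / n ≤ 1 := by
        rw [div_le_one hn0]; exact_mod_cast (by omega : k ≤ n)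
      have hk0 : (0 : ℝ) ≤ k / n := by positivity
      have hkt : (k : ℝ) * (t / n) = k / n * t := by ring
      have hlo : min 0 t ≤ k * (t / n) := by
        rw [hkt]
        rcases le_total 0 t with h | h
        · rw [min_eq_left h]; positivity
        · rw [min_eq_right h]; nlinarith
      have hhi : k * (t / n) ≤ max 0 t := by
        rw [hkt]
        rcases le_total 0 t with h | h
        · rw [max_eq_right h]; nlinarith
        · rw [max_eq_left h]; nlinarith
      obtain ⟨h3, h4⟩ := eqOn_complexMGF_of_analytic_strip μ hr
        (hG.mono fun z hz ↦ ⟨by linarith [hz.1], by linarith [hz.2]⟩) h1 h2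
      rw [abs_lt] at hstep
      have hmem : ((k + 1 : ℕ) : ℝ) * (t / n) ∈
          Set.Ioo (k * (t / n) - r) (k * (t / n) + r) := by
        push_cast
        constructor <;> linarith [hstep.1, hstep.2]
      refine ⟨h3 hmem, h4.mono fun z hz ↦ ?_⟩
      simp only [Set.mem_ofPred_eq] at hz ⊢
      rwa [hz]
  have := key n le_rfl
  rwa [mul_div_cancel₀ _ hn0.ne'] at this

theorem IsCharFunOnStrip.eq_complexMGF {μ : Measure ℝ} [IsFiniteMeasure μ] {pₗ pᵤ : EReal}
    {φ : ℂ → ℂ} (hφ : IsCharFunOnStrip μ pₗ pᵤ φ) {b : ℝ} (hl : pₗ < (b : EReal))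
    (hu : (b : EReal) < pᵤ) :
    -b ∈ integrableExpSet id μ ∧
      ∀ u : ℝ, φ (u + I * b) = complexMGF id μ (I * (u + I * b)) := by
  obtain ⟨α, hα, hα'⟩ := EReal.lt_iff_exists_real_btwn.1 (lt_min hφ.neg hl)
  obtain ⟨β, hβ, hβ'⟩ := EReal.lt_iff_exists_real_btwn.1 (max_lt hφ.pos hu)
  rw [lt_min_iff] at hα'
  rw [max_lt_iff] at hβ
  have hα0 : α < 0 := by exact_mod_cast hα'.1
  have hαb : α < b := by exact_mod_cast hα'.2
  have hβ0 : 0 < β := by exact_mod_cast hβ.1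
  have hβb : b < β := by exact_mod_cast hβ.2
  -- The rotation z ↦ -iz carries the vertical strip of the moment generating function to the
  -- horizontal strip of φ.
  have hG : AnalyticOnNhd ℂ (fun z ↦ φ (-(I * z))) {z | z.re ∈ Set.Ioo (-β) (-α)} := by
    refine AnalyticOnNhd.comp (t := horizontalStrip pₗ pᵤ) hφ.analytic
      (fun z _ ↦ by fun_prop) fun z hz ↦ ?_
    simp only [Set.mem_ofPred_eq, Set.mem_Ioo] at hz
    simp only [horizontalStrip, Set.mem_ofPred_eq, neg_im, mul_im, I_re, I_im, zero_mul, one_mul,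
      zero_add]
    exact ⟨hα.trans (by exact_mod_cast (by linarith : α < -z.re)),
      lt_trans (by exact_mod_cast (by linarith : -z.re < β)) hβ'⟩
  obtain ⟨h1, h2⟩ := eqOn_complexMGF_of_analyticOnNhd μ (neg_lt_zero.2 hβ0) (neg_pos.2 hα0) hG
    (fun u ↦ by
      rw [← hφ.eq_charFun]
      congr 1
      linear_combination (-(u : ℂ)) * I_mul_I) (t := -b) ⟨by linarith, by linarith⟩
  refine ⟨h1, fun u ↦ ?_⟩
  rw [← h2 (by simp)]
  congr 1
  linear_combination (u + I * b : ℂ) * I_mul_I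

/-! ### The damped distribution function and its transform -/

/-- The indicator of `z ≤ y`, shifted by the constant that makes it integrable against
`exp (-a y)`. -/
noncomputable def shiftedIndicator (a y z : ℝ) : ℝ := (if z ≤ y then 1 else 0) - residueTerm a

/-- The distribution function of `μ`, minus `residueTerm a`. -/
noncomputable def shiftedCdf (μ : Measure ℝ) (a y : ℝ) : ℝ := cdf μ y - residueTerm a

/-- The transform `∫ exp (-(a - i u) y) (P y - R_a) dy`. -/
noncomputable def cdfTransform (μ : Measure ℝ) (a u : ℝ) : ℂ :=
  complexMGF id μ (-((a : ℂ) - u * I)) / ((a : ℂ) - u * I)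

theorem residueTerm_of_pos {a : ℝ} (ha : 0 < a) : residueTerm a = 0 := if_pos ha

theorem residueTerm_of_neg {a : ℝ} (ha : a < 0) : residueTerm a = 1 := if_neg ha.not_gt

theorem shiftedIndicator_of_pos {a : ℝ} (ha : 0 < a) (y z : ℝ) :
    shiftedIndicator a y z = (Set.Ici z).indicator 1 y := by
  simp [shiftedIndicator, residueTerm_of_pos ha, Set.indicator_apply]

theorem shiftedIndicator_of_neg {a : ℝ} (ha : a < 0) (y z : ℝ) :
    shiftedIndicator a y z = -(Set.Iio z).indicator 1 y := by
  by_cases h : z ≤ y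
  · simp [shiftedIndicator, residueTerm_of_neg ha, h]
  · simp [shiftedIndicator, residueTerm_of_neg ha, h, not_le.1 h]

theorem abs_shiftedIndicator {a : ℝ} (ha : a ≠ 0) (y z : ℝ) :
    |shiftedIndicator a y z| = SignType.sign a * shiftedIndicator a y z := by
  rcases ha.lt_or_gt with h | h
  · rw [shiftedIndicator_of_neg h, sign_neg h]
    by_cases hy : y < z <;> simp [hy]
  · rw [shiftedIndicator_of_pos h, sign_pos h]
    by_cases hy : z ≤ y <;> simp [hy]

theorem abs_shiftedIndicator_le_one {a : ℝ} (ha : a ≠ 0) (y z : ℝ) :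
    |shiftedIndicator a y z| ≤ 1 := by
  rcases ha.lt_or_gt with h | h
  · rw [shiftedIndicator_of_neg h, abs_neg]
    by_cases hy : y < z <;> simp [hy]
  · rw [shiftedIndicator_of_pos h]
    by_cases hy : z ≤ y <;> simp [hy]

/-- Exponential Chebyshev: where the left side is nonzero, a(y - z) ≥ 0. Doubling the exponent here
is what brings φ_Z(2ia) into the final bound. -/
theorem abs_shiftedIndicator_le_exp {a : ℝ} (ha : a ≠ 0) (y z : ℝ) :
    |shiftedIndicator a y z| ≤ Real.exp (2 * a * y) * Real.exp (-(2 * a) * z) := by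
  rw [← Real.exp_add]
  rcases ha.lt_or_gt with h | h
  · rw [shiftedIndicator_of_neg h, abs_neg]
    by_cases hy : y < z
    · simp only [Set.indicator_apply, Set.mem_Iio, hy, if_true, Pi.one_apply, abs_one]
      exact Real.one_le_exp (by nlinarith)
    · simpa [Set.indicator_apply, hy] using (Real.exp_pos _).le
  · rw [shiftedIndicator_of_pos h]
    by_cases hy : z ≤ y
    · simp only [Set.indicator_apply, Set.mem_Ici, hy, if_true, Pi.one_apply, abs_one]
      exact Real.one_le_exp (by nlinarith)
    · simpa [Set.indicator_apply, hy] using (Real.exp_pos _).le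

theorem measurable_shiftedIndicator (a : ℝ) :
    Measurable fun p : ℝ × ℝ ↦ shiftedIndicator a p.1 p.2 :=
  (Measurable.ite (measurableSet_le measurable_snd measurable_fst) measurable_const
    measurable_const).sub_const _

/-- Subtracting `residueTerm` leaves exactly the half-line on which e^{-sy} is integrable, and both
signs of Re s give the same formula. -/
theorem shiftedIndicator_mul_exp {s : ℂ} (hs : s.re ≠ 0) (z : ℝ) :
    Integrable (fun y : ℝ ↦ (shiftedIndicator s.re y z : ℂ) * cexp (-s * y)) ∧
      ∫ y : ℝ, (shiftedIndicator s.re y z : ℂ) * cexp (-s * y) = cexp (-s * z) / s := by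
  rcases hs.lt_or_gt with h | h
  · have hs' : 0 < (-s).re := by simpa using h
    have heq : (fun y : ℝ ↦ (shiftedIndicator s.re y z : ℂ) * cexp (-s * y)) =
        fun y ↦ -(Set.Iio z).indicator (fun y : ℝ ↦ cexp (-s * y)) y := by
      ext y
      rw [shiftedIndicator_of_neg h]
      by_cases hy : y < z <;> simp [hy]
    rw [heq]
    constructor
    · refine ((integrable_indicator_iff measurableSet_Iio).2 ?_).neg
      exact (integrableOn_exp_mul_complex_Iic hs' z).mono_set Set.Iio_subset_Iic_self
    · rw [integral_neg, integral_indicator measurableSet_Iio, ← integral_Iic_eq_integral_Iio,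
        integral_exp_mul_complex_Iic hs', div_neg, neg_neg]
  · have hs' : (-s).re < 0 := by simpa using h
    have heq : (fun y : ℝ ↦ (shiftedIndicator s.re y z : ℂ) * cexp (-s * y)) =
        fun y ↦ (Set.Ici z).indicator (fun y : ℝ ↦ cexp (-s * y)) y := by
      ext y
      rw [shiftedIndicator_of_pos h]
      by_cases hy : z ≤ y <;> simp [hy]
    rw [heq]
    constructor
    · refine (integrable_indicator_iff measurableSet_Ici).2 ?_
      rw [integrableOn_Ici_iff_integrableOn_Ioi]
      exact integrableOn_exp_mul_complex_Ioi hs' z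
    · rw [integral_indicator measurableSet_Ici, integral_Ici_eq_integral_Ioi,
        integral_exp_mul_complex_Ioi hs', neg_div_neg_eq]

theorem integrable_shiftedIndicator_mul_exp (μ : Measure ℝ) [IsFiniteMeasure μ] {s : ℂ}
    (hs : s.re ≠ 0) (hμ : Integrable (fun x ↦ Real.exp (-s.re * x)) μ) :
    Integrable (Function.uncurry fun y z : ℝ ↦ (shiftedIndicator s.re y z : ℂ) * cexp (-s * y))
      (volume.prod μ) := by
  have hm : Measurable (Function.uncurry fun y z : ℝ ↦
      (shiftedIndicator s.re y z : ℂ) * cexp (-s * y)) :=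
    (measurable_ofReal.comp (measurable_shiftedIndicator s.re)).mul (by fun_prop)
  rw [integrable_prod_iff' hm.aestronglyMeasurable]
  refine ⟨ae_of_all _ fun z ↦ (shiftedIndicator_mul_exp hs z).1, ?_⟩
  -- By constancy of sign, the integral of the norm is the transform itself at the real point Re s,
  -- hence explicit.
  refine (hμ.const_mul ((SignType.sign s.re : ℝ) / s.re)).congr (ae_of_all _ fun z ↦ ?_)
  have hnorm : ∀ y : ℝ, ‖(shiftedIndicator s.re y z : ℂ) * cexp (-s * y)‖ =
      (SignType.sign s.re : ℝ) * (shiftedIndicator s.re y z * Real.exp (-s.re * y)) := by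
    intro y
    rw [norm_mul, norm_real, Real.norm_eq_abs, abs_shiftedIndicator hs, norm_exp]
    simp [mul_assoc]
  simp only [Function.uncurry]
  simp_rw [hnorm]
  rw [integral_const_mul, div_mul_eq_mul_div, mul_div_assoc]
  congr 1
  have := (shiftedIndicator_mul_exp (s := (s.re : ℂ)) (by simpa using hs) z).2
  simp only [ofReal_re] at this
  apply ofReal_injective
  rw [← integral_complex_ofReal]
  push_cast
  exact this.symm

theorem shiftedCdf_eq_integral (μ : Measure ℝ) [IsProbabilityMeasure μ] (a y : ℝ) :
    shiftedCdf μ a y = ∫ z, shiftedIndicator a y z ∂μ := by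
  have h : (fun z ↦ shiftedIndicator a y z) =
      fun z ↦ (Set.Iic y).indicator 1 z - residueTerm a := by
    ext z; simp [shiftedIndicator, Set.indicator_apply]
  rw [h, integral_sub ((integrable_const 1).indicator measurableSet_Iic) (integrable_const _),
    integral_indicator_one measurableSet_Iic, shiftedCdf, cdf_eq_real]
  simp

theorem integrable_shiftedIndicator (μ : Measure ℝ) [IsFiniteMeasure μ] {a : ℝ} (ha : a ≠ 0)
    (y : ℝ) : Integrable (fun z ↦ shiftedIndicator a y z) μ :=
  (integrable_const (1 : ℝ)).mono'
    ((measurable_shiftedIndicator a).comp measurable_prodMk_left).aestronglyMeasurable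
    (ae_of_all _ fun z ↦ abs_shiftedIndicator_le_one ha y z)

theorem abs_shiftedCdf (μ : Measure ℝ) [IsProbabilityMeasure μ] {a : ℝ} (ha : a ≠ 0) (y : ℝ) :
    |shiftedCdf μ a y| = SignType.sign a * shiftedCdf μ a y := by
  have h0 : 0 ≤ SignType.sign a * shiftedCdf μ a y := by
    rw [shiftedCdf_eq_integral, ← integral_const_mul]
    refine integral_nonneg fun z ↦ ?_
    simp only [← abs_shiftedIndicator ha]
    exact abs_nonneg _
  rw [← abs_of_nonneg h0, abs_mul]
  rcases ha.lt_or_gt with h | h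
  · simp [sign_neg h]
  · simp [sign_pos h]

theorem abs_shiftedCdf_le_one (μ : Measure ℝ) [IsProbabilityMeasure μ] {a : ℝ} (ha : a ≠ 0)
    (y : ℝ) : |shiftedCdf μ a y| ≤ 1 := by
  rw [shiftedCdf_eq_integral]
  refine (abs_integral_le_integral_abs).trans ?_
  refine (integral_mono (integrable_shiftedIndicator μ ha y).abs (integrable_const 1)
    fun z ↦ abs_shiftedIndicator_le_one ha y z).trans ?_
  simp

theorem abs_shiftedCdf_le_exp (μ : Measure ℝ) [IsProbabilityMeasure μ] {a : ℝ} (ha : a ≠ 0)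
    (hμ : Integrable (fun x ↦ Real.exp (-(2 * a) * x)) μ) (y : ℝ) :
    |shiftedCdf μ a y| ≤ Real.exp (2 * a * y) * mgf id μ (-(2 * a)) := by
  rw [shiftedCdf_eq_integral, mgf, ← integral_const_mul]
  refine (abs_integral_le_integral_abs).trans ?_
  exact integral_mono (integrable_shiftedIndicator μ ha y).abs (hμ.const_mul _)
    fun z ↦ abs_shiftedIndicator_le_exp ha y z

theorem shiftedCdf_mul_exp (μ : Measure ℝ) [IsProbabilityMeasure μ] {a : ℝ} (ha : a ≠ 0)
    (hμ : Integrable (fun x ↦ Real.exp (-a * x)) μ) (u : ℝ) :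
    Integrable (fun y : ℝ ↦ (shiftedCdf μ a y : ℂ) * cexp (-((a : ℂ) - u * I) * y)) ∧
      ∫ y : ℝ, (shiftedCdf μ a y : ℂ) * cexp (-((a : ℂ) - u * I) * y) = cdfTransform μ a u := by
  set s : ℂ := (a : ℂ) - u * I
  have hsa : s.re = a := by simp [s]
  have hI := integrable_shiftedIndicator_mul_exp μ (s := s) (by rwa [hsa]) (by rwa [hsa])
  have heq : ∀ y : ℝ, (shiftedCdf μ a y : ℂ) * cexp (-s * y) =
      ∫ z, (shiftedIndicator s.re y z : ℂ) * cexp (-s * y) ∂μ := by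
    intro y
    rw [integral_mul_const, integral_complex_ofReal, hsa, shiftedCdf_eq_integral]
  simp_rw [heq]
  refine ⟨hI.integral_prod_left, ?_⟩
  rw [integral_integral_swap hI]
  simp_rw [fun z ↦ (shiftedIndicator_mul_exp (s := s) (by rwa [hsa]) z).2]
  rw [integral_div, cdfTransform, complexMGF]
  rfl

/-- Use |Q| ≤ 1 where ay ≥ 0 and the Chebyshev bound where ay ≤ 0. -/
theorem norm_shiftedCdf_mul_exp_le (μ : Measure ℝ) [IsProbabilityMeasure μ] {a : ℝ} (ha : a ≠ 0)
    (hμ : Integrable (fun x ↦ Real.exp (-(2 * a) * x)) μ) (y : ℝ) :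
    ‖(shiftedCdf μ a y : ℂ) * cexp (-(a : ℂ) * y)‖ ≤
      (1 + mgf id μ (-(2 * a))) * Real.exp (-|a| * |y|) := by
  have hM : 0 ≤ mgf id μ (-(2 * a)) := mgf_nonneg
  have hnorm : ‖(shiftedCdf μ a y : ℂ) * cexp (-(a : ℂ) * y)‖ =
      |shiftedCdf μ a y| * Real.exp (-(a * y)) := by
    rw [norm_mul, norm_real, Real.norm_eq_abs, norm_exp]
    simp
  rw [hnorm]
  have hay : -|a| * |y| = -|a * y| := by rw [abs_mul, neg_mul]
  rw [hay]
  have hexp := Real.exp_pos (-|a * y|)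
  rcases le_total 0 (a * y) with h | h
  · rw [abs_of_nonneg h] at hexp ⊢
    nlinarith [abs_shiftedCdf_le_one μ ha y, mul_nonneg hM hexp.le]
  · rw [abs_of_nonpos h, neg_neg] at hexp ⊢
    have h1 := mul_le_mul_of_nonneg_right (abs_shiftedCdf_le_exp μ ha hμ y)
      (Real.exp_pos (-(a * y))).le
    have h2 : Real.exp (2 * a * y) * mgf id μ (-(2 * a)) * Real.exp (-(a * y)) =
        mgf id μ (-(2 * a)) * Real.exp (a * y) := by
      rw [mul_comm (Real.exp (2 * a * y)), mul_assoc, ← Real.exp_add]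
      ring_nf
    nlinarith

theorem fourier_shiftedCdf_mul_exp (μ : Measure ℝ) [IsProbabilityMeasure μ] {a : ℝ} (ha : a ≠ 0)
    (hμ : Integrable (fun x ↦ Real.exp (-a * x)) μ) (w : ℝ) :
    𝓕 (fun y : ℝ ↦ (shiftedCdf μ a y : ℂ) * cexp (-(a : ℂ) * y)) w =
      cdfTransform μ a (-2 * Real.pi * w) := by
  rw [Real.fourier_real_eq_integral_exp_smul, ← (shiftedCdf_mul_exp μ ha hμ _).2]
  congr 1 with y
  rw [smul_eq_mul, mul_left_comm, ← Complex.exp_add]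
  congr 2
  push_cast; ring

/-! ### Fourier inversion, continuity and Poisson summation -/

/-- The transform is integrable because b > 1, so Fourier inversion recovers F at every continuity
point from a continuous function. A distribution function is right-continuous with countably many
jumps, so the equality extends to all points. -/
theorem continuous_shiftedCdf (μ : Measure ℝ) [IsProbabilityMeasure μ] {a : ℝ} (ha : a ≠ 0)
    (hμ : Integrable (fun x ↦ Real.exp (-a * x)) μ) {C b : ℝ} (hb : 1 < b)
    (hC : ∀ u, ‖cdfTransform μ a u‖ ≤ C * (1 + |u|) ^ (-b)) :
    Continuous (shiftedCdf μ a) := by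
  set F : ℝ → ℂ := fun y ↦ (shiftedCdf μ a y : ℂ) * cexp (-(a : ℂ) * y) with hF
  have hFi : Integrable F := by
    simpa only [ofReal_zero, zero_mul, sub_zero] using (shiftedCdf_mul_exp μ ha hμ 0).1
  have hcont : ∀ f : ℝ → ℂ, Integrable f → Continuous (𝓕 f) := fun f hf ↦
    VectorFourier.fourierIntegral_continuous Real.continuous_fourierChar
      (by exact continuous_inner) hf
  have hFF : Integrable (𝓕 F) := by
    have hint : Integrable fun w : ℝ ↦ C * (1 + ‖w * (-2 * Real.pi)‖) ^ (-b) :=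
      ((integrable_one_add_norm (μ := volume) (E := ℝ) (r := b) (by simpa using hb)).comp_mul_right'
        (by simp [Real.pi_ne_zero])).const_mul C
    refine hint.mono' (hcont F hFi).aestronglyMeasurable (ae_of_all _ fun w ↦ ?_)
    rw [hF, fourier_shiftedCdf_mul_exp μ ha hμ, Real.norm_eq_abs, mul_comm w]
    exact hC _
  have hG : Continuous (𝓕⁻ (𝓕 F)) := by
    have : 𝓕⁻ (𝓕 F) = fun w ↦ 𝓕 (𝓕 F) (-w) := by
      ext w; exact Real.fourierInv_eq_fourier_neg _ _
    rw [this]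
    exact (hcont _ hFF).comp continuous_neg
  have hFat : ∀ y, ContinuousAt (cdf μ) y → 𝓕⁻ (𝓕 F) y = F y := by
    intro y hy
    refine hFi.fourierInv_fourier_eq hFF ?_
    exact (continuous_ofReal.continuousAt.comp (hy.sub continuousAt_const)).mul (by fun_prop)
  have hright : ∀ x, ContinuousWithinAt F (Set.Ioi x) x := by
    intro x
    have h1 : ContinuousWithinAt (shiftedCdf μ a) (Set.Ioi x) x :=
      (((cdf μ).right_continuous x).mono Set.Ioi_subset_Ici_self).sub continuousWithinAt_const
    exact (continuous_ofReal.continuousAt.comp_continuousWithinAt h1).mul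
      (by fun_prop : Continuous fun y : ℝ ↦ cexp (-(a : ℂ) * y)).continuousWithinAt
  have heq : ∀ x, F x = 𝓕⁻ (𝓕 F) x := by
    intro x
    refine tendsto_nhds_unique_of_frequently_eq (hright x) hG.continuousWithinAt ?_
    have hdense : Dense {y | ¬ ContinuousAt (cdf μ) y}ᶜ :=
      (monotone_cdf μ).countable_not_continuousAt.dense_compl ℝ
    rw [frequently_iff]
    intro U hU
    obtain ⟨c, hc, hcU⟩ := mem_nhdsGT_iff_exists_Ioo_subset.1 hU
    obtain ⟨y, hy, hy'⟩ := hdense.exists_mem_open isOpen_Ioo (Set.nonempty_Ioo.2 hc)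
    exact ⟨y, hcU hy', (hFat y (not_not.1 hy)).symm⟩
  have hQ : shiftedCdf μ a = fun y ↦ (𝓕⁻ (𝓕 F) y * cexp ((a : ℂ) * y)).re := by
    ext y
    rw [← heq, hF, mul_assoc, ← Complex.exp_add]
    simp
  rw [hQ]
  exact continuous_re.comp (hG.mul (by fun_prop))

theorem cdfTransform_neg (μ : Measure ℝ) (a u : ℝ) :
    cdfTransform μ a (-u) = (starRingEnd ℂ) (cdfTransform μ a u) := by
  simp only [cdfTransform, complexMGF, map_div₀, ← integral_conj, ← Complex.exp_conj]
  simp [sub_eq_add_neg]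

/-- The node `(n + 1/2) h` for an integer `n`. -/
noncomputable def intNode (h : ℝ) (n : ℤ) : ℝ := ((n : ℝ) + 1 / 2) * h

theorem isBigO_exp_neg_abs {c : ℝ} (hc : 0 < c) (b : ℝ) :
    (fun x : ℝ ↦ Real.exp (-c * |x|)) =O[cocompact ℝ] fun x ↦ |x| ^ b :=
  (isLittleO_exp_neg_mul_rpow_atTop hc b).isBigO.comp_tendsto
    (tendsto_norm_cocompact_atTop (E := ℝ))

/-- Poisson summation for the exponentially damped distribution function. -/
theorem tsum_alternating_shiftedCdf (μ : Measure ℝ) [IsProbabilityMeasure μ] {a : ℝ} (ha : a ≠ 0)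
    (hμ : Integrable (fun x ↦ Real.exp (-a * x)) μ)
    (hμ2 : Integrable (fun x ↦ Real.exp (-(2 * a) * x)) μ) {C b : ℝ} (hb : 1 < b)
    (hC : ∀ u, ‖cdfTransform μ a u‖ ≤ C * (1 + |u|) ^ (-b)) {h : ℝ} (hh : 0 < h) (x : ℝ) :
    (Summable fun n : ℤ ↦ ‖cdfTransform μ a (-intNode h n)‖) ∧
    ∑' k : ℤ, (((-1) ^ k * (Real.exp (-(a * (k * (2 * Real.pi / h)))) *
        shiftedCdf μ a (x + k * (2 * Real.pi / h))) : ℝ) : ℂ) =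
      h * Real.exp (a * x) / (2 * Real.pi) *
        ∑' n : ℤ, cdfTransform μ a (-intNode h n) * cexp (I * x * intNode h n) := by
  set T : ℝ := 2 * Real.pi / h with hT
  have hT0 : 0 < T := by positivity
  set F : ℝ → ℂ := fun y ↦ (shiftedCdf μ a y : ℂ) * cexp (-(a : ℂ) * y) with hF
  -- The factor e^{-iπt} displaces the frequencies by 1/2, producing the nodes (n + 1/2)h, and
  -- becomes (-1)^k under integer translation.
  set f : ℝ → ℂ := fun t ↦ F (t * T) * cexp (-(Real.pi * I * t)) with hf
  have hFc : Continuous F :=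
    (continuous_ofReal.comp (continuous_shiftedCdf μ ha hμ hb hC)).mul (by fun_prop)
  have hfc : Continuous f := (hFc.comp (by fun_prop)).mul (by fun_prop)
  have hfO : f =O[cocompact ℝ] fun t ↦ |t| ^ (-b) := by
    refine Asymptotics.IsBigO.trans ?_ (isBigO_exp_neg_abs (c := |a| * T) (by positivity) (-b))
    refine Asymptotics.IsBigO.of_bound (1 + mgf id μ (-(2 * a))) (Eventually.of_forall fun t ↦ ?_)
    have h1 := norm_shiftedCdf_mul_exp_le μ ha hμ2 (t * T)
    rw [hf, norm_mul, norm_exp, Real.norm_of_nonneg (Real.exp_pos _).le]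
    have h2 : (-(Real.pi * I * t) : ℂ).re = 0 := by simp
    rw [h2, Real.exp_zero, mul_one]
    refine h1.trans_eq ?_
    rw [abs_mul, abs_of_pos hT0]
    ring_nf
  have hfour : ∀ w : ℝ, 𝓕 f w = T⁻¹ * cdfTransform μ a (-((w + 1 / 2) * h)) := by
    intro w
    rw [Real.fourier_real_eq_integral_exp_smul, ← (shiftedCdf_mul_exp μ ha hμ _).2]
    have := Measure.integral_comp_mul_right (fun y : ℝ ↦ (shiftedCdf μ a y : ℂ) *
      cexp (-((a : ℂ) - (-((w + 1 / 2) * h) : ℝ) * I) * y)) T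
    rw [abs_of_pos (inv_pos.2 hT0), real_smul] at this
    rw [← this]
    congr 1 with v
    rw [smul_eq_mul, hf, hF]
    simp only
    rw [mul_left_comm, ← Complex.exp_add, mul_assoc (shiftedCdf μ a (v * T) : ℂ),
      ← Complex.exp_add]
    congr 2
    have hhT : (h : ℂ) * T = 2 * Real.pi := by
      rw [hT]; push_cast; field_simp [ofReal_ne_zero.2 hh.ne']
    push_cast
    linear_combination ((w + 1 / 2) * v * I : ℂ) * hhT
  have hFO : 𝓕 f =O[cocompact ℝ] fun w ↦ |w| ^ (-b) := by
    have hC0 : 0 ≤ C := by simpa using (norm_nonneg _).trans (hC 0)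
    refine Asymptotics.IsBigO.of_bound (T⁻¹ * (C * (h / 2) ^ (-b))) ?_
    filter_upwards [(tendsto_norm_cocompact_atTop (E := ℝ)).eventually_ge_atTop 1] with w hw
    rw [Real.norm_eq_abs] at hw
    rw [hfour, norm_mul, norm_real, Real.norm_of_nonneg (inv_pos.2 hT0).le, mul_assoc]
    refine mul_le_mul_of_nonneg_left ((hC _).trans ?_) (inv_pos.2 hT0).le
    rw [Real.norm_of_nonneg (by positivity), mul_assoc,
      ← Real.mul_rpow (by positivity) (by positivity)]
    refine mul_le_mul_of_nonneg_left ?_ hC0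
    refine Real.rpow_le_rpow_of_nonpos (by positivity) ?_ (by linarith)
    -- This needs |w| ≥ 1 and accounts for h/2 in the constant.
    have h1 : |w| / 2 ≤ |w + 1 / 2| := by
      have := abs_sub_abs_le_abs_sub w (-(1 / 2))
      rw [sub_neg_eq_add, abs_neg, abs_of_pos (by norm_num : (0 : ℝ) < 1 / 2)] at this
      linarith
    rw [abs_neg, abs_mul, abs_of_pos hh]
    nlinarith
  have hP := Real.tsum_eq_tsum_fourier_of_rpow_decay hfc hb hfO hFO (x / T)
  have hTC : (T : ℂ) ≠ 0 := ofReal_ne_zero.2 hT0.ne'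
  have hhC : (h : ℂ) ≠ 0 := ofReal_ne_zero.2 hh.ne'
  have hpiC : (Real.pi : ℂ) ≠ 0 := ofReal_ne_zero.2 Real.pi_ne_zero
  have hTeq : (T : ℂ) = 2 * Real.pi / h := by rw [hT]; push_cast; rfl
  refine ⟨?_, ?_⟩
  · refine (summable_of_isBigO (Real.summable_abs_int_rpow hb)
      (hFO.comp_tendsto Int.tendsto_coe_cofinite)).norm.mul_left T |>.congr fun n ↦ ?_
    simp only [Function.comp_apply]
    rw [hfour, norm_mul, norm_real, Real.norm_of_nonneg (inv_pos.2 hT0).le,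
      mul_inv_cancel_left₀ hT0.ne', intNode]
  have hleft : ∀ k : ℤ, (((-1) ^ k * (Real.exp (-(a * (k * T))) *
      shiftedCdf μ a (x + k * T)) : ℝ) : ℂ) =
      cexp (a * x + Real.pi * I * (x / T)) * f (x / T + k) := by
    intro k
    have h1 : (x / T + k) * T = x + k * T := by field_simp
    have h2 : ((-1 : ℂ)) ^ k = cexp (-(Real.pi * I * k)) := by
      have : cexp (-(Real.pi * I)) = -1 := by rw [Complex.exp_neg, Complex.exp_pi_mul_I]; norm_num
      rw [← this, ← Complex.exp_int_mul]
      ring_nf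
    simp only [hf, hF, h1]
    push_cast
    rw [h2]
    have h3 : cexp (-(Real.pi * I * k)) * cexp (-(a * (k * T))) =
        cexp (a * x + Real.pi * I * (x / T)) *
          (cexp (-a * (x + k * T)) * cexp (-(Real.pi * I * (x / T + k)))) := by
      simp only [← Complex.exp_add]
      congr 1
      ring
    linear_combination (shiftedCdf μ a (x + k * T) : ℂ) * h3
  have hright : ∀ n : ℤ, h * cexp (a * x) / (2 * Real.pi) * (cdfTransform μ a (-intNode h n) *
      cexp (I * x * intNode h n)) = cexp (a * x + Real.pi * I * (x / T)) *
      (𝓕 f n * fourier n ((x / T : ℝ) : UnitAddCircle)) := by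
    intro n
    rw [hfour, fourier_coe_apply]
    have : cexp (I * x * intNode h n) = cexp (Real.pi * I * (x / T)) *
        cexp (2 * Real.pi * I * n * (x / T : ℝ) / (1 : ℝ)) := by
      rw [← Complex.exp_add]
      congr 1
      rw [intNode]
      push_cast
      rw [hTeq]
      field_simp
      ring
    rw [this, Complex.exp_add, intNode]
    push_cast
    rw [hTeq, inv_div]
    ring
  rw [← tsum_mul_left, ofReal_exp, ofReal_mul]
  simp_rw [hleft, hright, tsum_mul_left, hP]

/-! ### Tails of midpoint sums -/

theorem convexOn_exp_comp {s : Set ℝ} {f : ℝ → ℝ} (hf : ConvexOn ℝ s f) :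
    ConvexOn ℝ s fun x ↦ Real.exp (f x) := by
  refine ⟨hf.1, fun x hx y hy p q hp hq hpq ↦ ?_⟩
  exact (Real.exp_le_exp.2 (hf.2 hx hy hp hq hpq)).trans
    (convexOn_exp.2 (Set.mem_univ _) (Set.mem_univ _) hp hq hpq)

theorem convexOn_rpow_of_nonpos {p : ℝ} (hp : p ≤ 0) :
    ConvexOn ℝ (Set.Ioi 0) fun x : ℝ ↦ x ^ p := by
  have h : ConvexOn ℝ (Set.Ioi 0) fun x : ℝ ↦ -((-p) * Real.log x) :=
    ((strictConcaveOn_log_Ioi.concaveOn.smul (neg_nonneg.2 hp)).neg)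
  refine (convexOn_exp_comp h).congr fun x hx ↦ ?_
  simp only
  rw [Real.rpow_def_of_pos hx]
  ring_nf

theorem convexOn_exp_neg_rpow_mul_rpow {l ω : ℝ} (hl : 0 ≤ l) (hω : 0 ≤ ω) (hω1 : ω ≤ 1) :
    ConvexOn ℝ (Set.Ioi 0) fun x : ℝ ↦ Real.exp (-l * x ^ ω) * x ^ (ω - 1) := by
  have h1 : ConvexOn ℝ (Set.Ioi 0) fun x : ℝ ↦ -((1 - ω) * Real.log x) :=
    ((strictConcaveOn_log_Ioi.concaveOn.smul (sub_nonneg.2 hω1)).neg)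
  have h2 : ConvexOn ℝ (Set.Ioi 0) fun x : ℝ ↦ -(l * x ^ ω) :=
    ((((Real.concaveOn_rpow hω hω1).subset Set.Ioi_subset_Ici_self (convex_Ioi 0)).smul hl).neg)
  refine (convexOn_exp_comp (h2.add h1)).congr fun x hx ↦ ?_
  simp only [Pi.add_apply]
  rw [Real.rpow_def_of_pos hx (ω - 1), ← Real.exp_add]
  ring_nf

/-- The midpoint rule underestimates the integral of a convex function. -/
theorem ConvexOn.midpoint_mul_le_sub {F g : ℝ → ℝ} (hg : ConvexOn ℝ (Set.Ioi 0) g)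
    (hF : ∀ x, 0 < x → HasDerivAt F (-g x) x) {m d : ℝ} (hd : 0 ≤ d) (hmd : 0 < m - d) :
    2 * d * g m ≤ F (m - d) - F (m + d) := by
  -- Differentiating in the half-width s reduces the claim to midpoint convexity of g.
  have hderiv : ∀ s ∈ Set.Icc 0 d, HasDerivAt (fun s ↦ F (m - s) - F (m + s) - 2 * s * g m)
      (g (m - s) + g (m + s) - 2 * g m) s := by
    intro s hs
    have h1 := (hF (m - s) (by linarith [hs.2])).comp s ((hasDerivAt_id s).const_sub m)
    have h2 := (hF (m + s) (by linarith [hs.1])).comp s ((hasDerivAt_id s).const_add m)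
    have h3 := ((hasDerivAt_id s).const_mul 2).mul_const (g m)
    convert! (h1.sub h2).sub h3 using 1
    ring
  have hmono : MonotoneOn (fun s ↦ F (m - s) - F (m + s) - 2 * s * g m) (Set.Icc 0 d) := by
    refine monotoneOn_of_deriv_nonneg (convex_Icc 0 d)
      (fun s hs ↦ (hderiv s hs).continuousAt.continuousWithinAt)
      (fun s hs ↦ (hderiv s (interior_subset hs)).differentiableAt.differentiableWithinAt)
      fun s hs ↦ ?_
    have hs' := interior_subset hs
    rw [(hderiv s hs').deriv]
    have := hg.2 (Set.mem_Ioi.2 (by linarith [hs'.2] : 0 < m - s))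
      (Set.mem_Ioi.2 (by linarith [hs'.1] : 0 < m + s)) (by norm_num : (0 : ℝ) ≤ 1 / 2)
      (by norm_num : (0 : ℝ) ≤ 1 / 2) (by norm_num)
    simp only [smul_eq_mul] at this
    rw [show 1 / 2 * (m - s) + 1 / 2 * (m + s) = m by ring] at this
    linarith
  have := hmono (Set.left_mem_Icc.2 hd) (Set.right_mem_Icc.2 hd) hd
  simp only [sub_zero, add_zero, sub_self, mul_zero, zero_mul] at this
  linarith

theorem sum_range_le_of_le_sub {f Φ : ℕ → ℝ} (h : ∀ j, f j ≤ Φ j - Φ (j + 1)) (hΦ : ∀ j, 0 ≤ Φ j)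
    (m : ℕ) : ∑ j ∈ Finset.range m, f j ≤ Φ 0 :=
  (Finset.sum_le_sum fun j _ ↦ h j).trans (by
    rw [Finset.sum_range_sub']; linarith [hΦ m])

theorem sum_midpoint_rpow_le {ω h : ℝ} (hω : 0 < ω) (hh : 0 < h) {N : ℕ} (hN : 0 < N) (m : ℕ) :
    ∑ j ∈ Finset.range m, h * (midpointNode h (N + j) ^ (-ω) / midpointNode h (N + j)) ≤
      (N * h) ^ (-ω) / ω := by
  have hN' : (0 : ℝ) < N := by exact_mod_cast hN
  have := sum_range_le_of_le_sub
    (f := fun j ↦ h * (midpointNode h (N + j) ^ (-ω) / midpointNode h (N + j)))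
    (Φ := fun j ↦ ((N + j : ℝ) * h) ^ (-ω) / ω) (fun j ↦ ?_) (fun j ↦ by positivity) m
  · simpa using this
  · have hm : 0 < midpointNode h (N + j) := by unfold midpointNode; positivity
    have key := (convexOn_rpow_of_nonpos (p := -ω - 1) (by linarith)).midpoint_mul_le_sub
      (F := fun x ↦ x ^ (-ω) / ω) (fun x hx ↦ by
        convert! (Real.hasDerivAt_rpow_const (p := -ω) (Or.inl hx.ne')).div_const ω using 1
        field_simp) (m := midpointNode h (N + j)) (d := h / 2) (by positivity)
        (by unfold midpointNode; push_cast; nlinarith [mul_pos hN' hh,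
              mul_nonneg (Nat.cast_nonneg (α := ℝ) j) hh.le])
    have e1 : midpointNode h (N + j) - h / 2 = (N + j : ℝ) * h := by
      unfold midpointNode; push_cast; ring
    have e2 : midpointNode h (N + j) + h / 2 = (N + (j + 1 : ℕ) : ℝ) * h := by
      unfold midpointNode; push_cast; ring
    simp only [e1, e2] at key
    rw [Real.rpow_sub_one hm.ne'] at key
    linarith

/-- Write e^{-lx^ω}/x as x^{-ω} times the convex function e^{-lx^ω} x^{ω-1}, whose antiderivative is
explicit, and bound x^{-ω} by (Nh)^{-ω}. -/
theorem sum_midpoint_exp_le_of_le_one {l ω h : ℝ} (hl : 0 < l) (hω : 0 < ω) (hω1 : ω ≤ 1)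
    (hh : 0 < h) {N : ℕ} (hN : 0 < N) (m : ℕ) :
    ∑ j ∈ Finset.range m,
        h * (Real.exp (-l * midpointNode h (N + j) ^ ω) / midpointNode h (N + j)) ≤
      Real.exp (-l * (N * h) ^ ω) / (ω * (l * (N * h) ^ ω)) := by
  have hN' : (0 : ℝ) < N := by exact_mod_cast hN
  have hX : (0 : ℝ) < N * h := by positivity
  have := sum_range_le_of_le_sub
    (f := fun j ↦ h * (Real.exp (-l * midpointNode h (N + j) ^ ω) / midpointNode h (N + j)))
    (Φ := fun j ↦ Real.exp (-l * ((N + j : ℝ) * h) ^ ω) / (ω * (l * (N * h) ^ ω))) (fun j ↦ ?_)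
    (fun j ↦ by positivity) m
  · simpa using this
  · have hm : 0 < midpointNode h (N + j) := by unfold midpointNode; positivity
    have key := (convexOn_exp_neg_rpow_mul_rpow hl.le hω.le hω1).midpoint_mul_le_sub
      (F := fun x ↦ Real.exp (-l * x ^ ω) / (ω * l)) (fun x hx ↦ by
        convert! (((Real.hasDerivAt_rpow_const (p := ω) (Or.inl hx.ne')).const_mul
          (-l)).exp).div_const (ω * l) using 1
        field_simp) (m := midpointNode h (N + j)) (d := h / 2) (by positivity)
        (by unfold midpointNode; push_cast; nlinarith [mul_pos hN' hh,
              mul_nonneg (Nat.cast_nonneg (α := ℝ) j) hh.le])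
    have e1 : midpointNode h (N + j) - h / 2 = (N + j : ℝ) * h := by
      unfold midpointNode; push_cast; ring
    have e2 : midpointNode h (N + j) + h / 2 = (N + (j + 1 : ℕ) : ℝ) * h := by
      unfold midpointNode; push_cast; ring
    simp only [e1, e2] at key
    rw [Real.rpow_sub_one hm.ne'] at key
    have hXm : (N * h : ℝ) ^ ω ≤ midpointNode h (N + j) ^ ω := by
      refine Real.rpow_le_rpow hX.le ?_ hω.le
      unfold midpointNode; push_cast
      gcongr
      linarith [Nat.cast_nonneg (α := ℝ) j]
    have hXp : (0 : ℝ) < (N * h : ℝ) ^ ω := by positivity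
    set E := Real.exp (-l * midpointNode h (N + j) ^ ω)
    have hE : 0 < E := Real.exp_pos _
    rw [← sub_div] at key ⊢
    rw [← mul_assoc, ← div_div, le_div_iff₀ hXp]
    refine le_trans ?_ key
    calc h * (E / midpointNode h (N + j)) * (N * h : ℝ) ^ ω
        ≤ h * (E / midpointNode h (N + j)) * midpointNode h (N + j) ^ ω := by gcongr
      _ = _ := by ring

/-- Convexity of e^{-lx^ω} x^{ω-1} on (0, ∞) fails for ω > 1. Bernoulli's inequality makes the
exponent at least t + s(j + 1/2), and the resulting geometric series is summed with s e^{-s/2} ≤ 1 -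
e^{-s}, that is, s/2 ≤ sinh(s/2). -/
theorem sum_midpoint_exp_le_of_one_le {l ω h : ℝ} (hl : 0 < l) (hω1 : 1 ≤ ω)
    (hh : 0 < h) {N : ℕ} (hN : 0 < N) (m : ℕ) :
    ∑ j ∈ Finset.range m,
        h * (Real.exp (-l * midpointNode h (N + j) ^ ω) / midpointNode h (N + j)) ≤
      Real.exp (-l * (N * h) ^ ω) / (ω * (l * (N * h) ^ ω)) := by
  have hN' : (0 : ℝ) < N := by exact_mod_cast hN
  have hX : (0 : ℝ) < N * h := by positivity
  have hω : 0 < ω := by linarith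
  set t : ℝ := l * (N * h) ^ ω with ht
  have ht0 : 0 < t := by positivity
  set s : ℝ := t * ω / N with hs
  have hs0 : 0 < s := by positivity
  have := sum_range_le_of_le_sub
    (f := fun j ↦ h * (Real.exp (-l * midpointNode h (N + j) ^ ω) / midpointNode h (N + j)))
    (Φ := fun j ↦ Real.exp (-l * (N * h) ^ ω) / (ω * t) * Real.exp (-(s * j))) (fun j ↦ ?_)
    (fun j ↦ by positivity) m
  · simpa using this
  · have hm : midpointNode h (N + j) = N * h * (1 + (j + 1 / 2) / N) := by
      unfold midpointNode; push_cast; field_simp; ring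
    have hmX : N * h ≤ midpointNode h (N + j) := by
      rw [hm]
      exact le_mul_of_one_le_right hX.le (by linarith [(by positivity : (0 : ℝ) ≤ (j + 1 / 2) / N)])
    have hbern : t + s * (j + 1 / 2) ≤ l * midpointNode h (N + j) ^ ω := by
      have h1 := one_add_mul_self_le_rpow_one_add (s := (j + 1 / 2 : ℝ) / N)
        (by linarith [(by positivity : (0 : ℝ) ≤ (j + 1 / 2) / N)]) hω1
      rw [hm, Real.mul_rpow hX.le (by positivity), ← mul_assoc, ← ht]
      calc t + s * (j + 1 / 2) = t * (1 + ω * ((j + 1 / 2) / N)) := by rw [hs]; field_simp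
        _ ≤ _ := by gcongr
    have hsinh : s * Real.exp (-(s / 2)) ≤ 1 - Real.exp (-s) := by
      have h1 := Real.self_le_sinh_iff.2 (by positivity : 0 ≤ s / 2)
      rw [Real.sinh_eq] at h1
      have h2 : Real.exp (-s) = Real.exp (-(s / 2)) * Real.exp (-(s / 2)) := by
        rw [← Real.exp_add]; ring_nf
      have h3 : Real.exp (s / 2) * Real.exp (-(s / 2)) = 1 := by
        rw [← Real.exp_add]; simp
      rw [h2]
      nlinarith [Real.exp_pos (-(s / 2))]
    have hE : Real.exp (-l * midpointNode h (N + j) ^ ω) ≤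
        Real.exp (-t) * Real.exp (-(s * j)) * Real.exp (-(s / 2)) := by
      rw [← Real.exp_add, ← Real.exp_add]
      exact Real.exp_le_exp.2 (by linarith)
    have hl' : -l * (N * h : ℝ) ^ ω = -t := by rw [ht]; ring
    rw [hl']
    calc h * (Real.exp (-l * midpointNode h (N + j) ^ ω) / midpointNode h (N + j))
        ≤ h * (Real.exp (-t) * Real.exp (-(s * j)) * Real.exp (-(s / 2)) / (N * h)) := by
          gcongr
      -- The prefactor is h/(Nh) = 1/N = s/(ωt).
      _ = Real.exp (-t) / (ω * t) * Real.exp (-(s * j)) * (s * Real.exp (-(s / 2))) := by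
          rw [hs]; field_simp
      _ ≤ Real.exp (-t) / (ω * t) * Real.exp (-(s * j)) * (1 - Real.exp (-s)) := by gcongr
      _ = _ := by
          have : Real.exp (-(s * (j + 1 : ℕ))) = Real.exp (-(s * j)) * Real.exp (-s) := by
            rw [← Real.exp_add]; push_cast; ring_nf
          rw [this]; ring

/-! ### The aliasing error -/

/-- The sum is E - O, its even part minus its odd part, and both E and O lie in [0, Dq/(1-q²)],
hence so does |E - O|. No monotonicity of `d` is needed, and the bound beats the q/(1-q) of the
triangle inequality. -/
theorem abs_tsum_alternating_le {d : ℕ → ℝ} {D q : ℝ} (hq0 : 0 < q) (hq1 : q < 1)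
    (hd0 : ∀ n, 0 ≤ d n) (hd : ∀ n, d n ≤ D * q ^ (n + 1)) :
    |∑' n, (-1) ^ n * d n| ≤ D * (q / (1 - q ^ 2)) := by
  have hq2 : q ^ 2 < 1 := by nlinarith
  have hD : 0 ≤ D := by
    have := (hd0 0).trans (hd 0)
    rw [zero_add, pow_one] at this
    exact nonneg_of_mul_nonneg_left this hq0
  have hgeo : HasSum (fun k : ℕ ↦ D * q * (q ^ 2) ^ k) (D * q * (1 - q ^ 2)⁻¹) :=
    (hasSum_geometric_of_lt_one (by positivity) hq2).mul_left _
  have hle_even : ∀ k, d (2 * k) ≤ D * q * (q ^ 2) ^ k := fun k ↦ (hd _).trans_eq (by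
    rw [pow_succ, pow_mul]; ring)
  have hle_odd : ∀ k, d (2 * k + 1) ≤ D * q * (q ^ 2) ^ k := fun k ↦ (hd _).trans (by
    rw [pow_succ, pow_succ, pow_mul]
    nlinarith [mul_nonneg (mul_nonneg hD hq0.le) (by positivity : 0 ≤ (q ^ 2) ^ k)])
  have hse : Summable fun k ↦ d (2 * k) :=
    Summable.of_nonneg_of_le (fun k ↦ hd0 _) hle_even hgeo.summable
  have hso : Summable fun k ↦ d (2 * k + 1) :=
    Summable.of_nonneg_of_le (fun k ↦ hd0 _) hle_odd hgeo.summable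
  have h1 : ∑' k, d (2 * k) ≤ D * q * (1 - q ^ 2)⁻¹ :=
    (hse.tsum_le_tsum hle_even hgeo.summable).trans_eq hgeo.tsum_eq
  have h2 : ∑' k, d (2 * k + 1) ≤ D * q * (1 - q ^ 2)⁻¹ :=
    (hso.tsum_le_tsum hle_odd hgeo.summable).trans_eq hgeo.tsum_eq
  have h3 : 0 ≤ ∑' k, d (2 * k) := tsum_nonneg fun k ↦ hd0 _
  have h4 : 0 ≤ ∑' k, d (2 * k + 1) := tsum_nonneg fun k ↦ hd0 _
  have e1 : ∀ k, (-1) ^ (2 * k) * d (2 * k) = d (2 * k) := fun k ↦ by simp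
  have e2 : ∀ k, (-1) ^ (2 * k + 1) * d (2 * k + 1) = -d (2 * k + 1) := fun k ↦ by
    simp [pow_succ]
  rw [← tsum_even_add_odd (by simpa only [e1] using hse) (by simpa only [e2] using hso.neg)]
  simp only [e1, e2, tsum_neg]
  rw [← mul_div_assoc, div_eq_mul_inv, abs_le]
  constructor <;> linarith

theorem abs_tsum_int_alternating_sub_le {c : ℤ → ℝ} {D q : ℝ} (hq0 : 0 < q) (hq1 : q < 1)
    (hc0 : ∀ k, 0 ≤ c k) (hc : ∀ n : ℕ, c (n + 1) + c (-(n + 1)) ≤ D * q ^ (n + 1)) :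
    |∑' k : ℤ, (-1) ^ k * c k - c 0| ≤ D * (q / (1 - q ^ 2)) := by
  have hgeo : Summable fun n : ℕ ↦ D * q ^ (n + 1) :=
    ((summable_nat_add_iff 1).2 (summable_geometric_of_lt_one hq0.le hq1)).mul_left _
  have hneg : ∀ n : ℕ, (-1 : ℝ) ^ (-(n + 1 : ℤ)) = -(-1) ^ n := by
    intro n
    rw [zpow_neg, show (n + 1 : ℤ) = ((n + 1 : ℕ) : ℤ) by push_cast; rfl, zpow_natCast, pow_succ]
    rcases neg_one_pow_eq_or ℝ n with h | h <;> rw [h] <;> norm_num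
  have hpos : ∀ n : ℕ, (-1 : ℝ) ^ (n + 1 : ℤ) = -(-1) ^ n := by
    intro n
    rw [show (n + 1 : ℤ) = ((n + 1 : ℕ) : ℤ) by push_cast; rfl, zpow_natCast, pow_succ]
    ring
  have hs1 : Summable fun n : ℕ ↦ (-1 : ℝ) ^ (n + 1 : ℤ) * c (n + 1) := by
    refine Summable.of_norm_bounded hgeo fun n ↦ ?_
    rw [hpos, norm_mul, norm_neg, norm_pow, norm_neg, norm_one, one_pow, one_mul,
      Real.norm_of_nonneg (hc0 _)]
    linarith [hc n, hc0 (-(n + 1))]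
  have hs2 : Summable fun n : ℕ ↦ (-1 : ℝ) ^ (-(n + 1 : ℤ)) * c (-(n + 1)) := by
    refine Summable.of_norm_bounded hgeo fun n ↦ ?_
    rw [hneg, norm_mul, norm_neg, norm_pow, norm_neg, norm_one, one_pow, one_mul,
      Real.norm_of_nonneg (hc0 _)]
    linarith [hc n, hc0 (n + 1)]
  have hsum : ∑' n : ℕ, (-1) ^ n * (c (n + 1) + c (-(n + 1))) =
      -(∑' n : ℕ, (-1 : ℝ) ^ (n + 1 : ℤ) * c (n + 1) +
        ∑' n : ℕ, (-1 : ℝ) ^ (-(n + 1 : ℤ)) * c (-(n + 1))) := by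
    rw [← hs1.tsum_add hs2, ← tsum_neg]
    refine tsum_congr fun n ↦ ?_
    rw [hneg, hpos]
    ring
  have hsplit := tsum_of_add_one_of_neg_add_one (f := fun k : ℤ ↦ (-1 : ℝ) ^ k * c k) hs1 hs2
  have hmain : ∑' k : ℤ, (-1) ^ k * c k - c 0 =
      -∑' n : ℕ, (-1) ^ n * (c (n + 1) + c (-(n + 1))) := by
    rw [hsplit, hsum, zpow_zero]
    ring
  rw [hmain, abs_neg]
  exact abs_tsum_alternating_le hq0 hq1 (fun n ↦ add_nonneg (hc0 _) (hc0 _)) hc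

/-- The aliasing error of the midpoint rule. -/
theorem abs_tsum_alternating_shiftedCdf_sub_le (μ : Measure ℝ) [IsProbabilityMeasure μ] {a : ℝ}
    (ha : a ≠ 0) (hμ2 : Integrable (fun x ↦ Real.exp (-(2 * a) * x)) μ) {T : ℝ} (hT : 0 < T)
    (x : ℝ) :
    |∑' k : ℤ, (-1) ^ k * (Real.exp (-(a * (k * T))) * shiftedCdf μ a (x + k * T)) -
        shiftedCdf μ a x| ≤
      1 / (Real.exp (|a| * T) - Real.exp (-(|a| * T))) *
        (1 + Real.exp (2 * a * x) * mgf id μ (-(2 * a))) := by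
  set M := mgf id μ (-(2 * a))
  set c : ℤ → ℝ := fun k ↦ Real.exp (-(a * (k * T))) * |shiftedCdf μ a (x + k * T)| with hc
  set q : ℝ := Real.exp (-(|a| * T)) with hq
  have haT : 0 < |a| * T := mul_pos (abs_pos.2 ha) hT
  have hq0 : 0 < q := Real.exp_pos _
  have hq1 : q < 1 := by rw [hq, Real.exp_lt_one_iff]; linarith
  have hqn : ∀ n : ℕ, q ^ (n + 1) = Real.exp (-(|a| * ((n + 1) * T))) := fun n ↦ by
    rw [hq, ← Real.exp_nat_mul]; push_cast; ring_nf
  have hc0 : ∀ k, 0 ≤ c k := fun k ↦ by positivity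
  have hc1 : ∀ k : ℤ, c k ≤ Real.exp (-(a * (k * T))) := fun k ↦
    mul_le_of_le_one_right (Real.exp_pos _).le (abs_shiftedCdf_le_one μ ha _)
  have hc2 : ∀ k : ℤ, c k ≤ Real.exp (2 * a * x) * M * Real.exp (a * (k * T)) := fun k ↦ by
    refine (mul_le_mul_of_nonneg_left (abs_shiftedCdf_le_exp μ ha hμ2 _)
      (Real.exp_pos _).le).trans_eq ?_
    rw [mul_add, Real.exp_add, show 2 * a * (k * T) = a * (k * T) + a * (k * T) by ring,
      Real.exp_add, Real.exp_neg]
    change _ * (_ * M) = _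
    field_simp
  -- In each pair ±(n+1), the index with ak > 0 is bounded through |Q| ≤ 1 and the other through the
  -- Chebyshev bound.
  have hdle : ∀ n : ℕ, c (n + 1) + c (-(n + 1)) ≤ (1 + Real.exp (2 * a * x) * M) * q ^ (n + 1) := by
    intro n
    rw [hqn]
    rcases ha.lt_or_gt with h | h
    · have h1 := hc2 (n + 1)
      have h2 := hc1 (-(n + 1))
      push_cast at h1 h2
      rw [abs_of_neg h]
      ring_nf at h1 h2 ⊢
      linarith
    · have h1 := hc1 (n + 1)
      have h2 := hc2 (-(n + 1))
      push_cast at h1 h2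
      rw [abs_of_pos h]
      ring_nf at h1 h2 ⊢
      linarith
  -- Q has the sign of a throughout; factoring it out leaves nonnegative terms with alternating
  -- signs.
  set σ : ℝ := ((SignType.sign a : SignType) : ℝ) with hσ
  have hσ1 : |σ| = 1 := by
    rcases ha.lt_or_gt with h | h
    · simp [hσ, sign_neg h]
    · simp [hσ, sign_pos h]
  have hσσ : σ * σ = 1 := by rw [← abs_mul_abs_self, hσ1, one_mul]
  have hterm : ∀ k : ℤ, (-1) ^ k * (Real.exp (-(a * (k * T))) * shiftedCdf μ a (x + k * T)) =
      σ * ((-1) ^ k * c k) := by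
    intro k
    simp only [hc]
    rw [abs_shiftedCdf μ ha, ← hσ]
    linear_combination (-((-1) ^ k * Real.exp (-(a * (k * T))) * shiftedCdf μ a (x + k * T))) * hσσ
  have h0 : shiftedCdf μ a x = σ * c 0 := by
    simpa using hterm 0
  rw [tsum_congr hterm, tsum_mul_left, h0, ← mul_sub, abs_mul, hσ1, one_mul]
  refine (abs_tsum_int_alternating_sub_le hq0 hq1 hc0 hdle).trans_eq ?_
  have : Real.exp (|a| * T) = q⁻¹ := by rw [hq, Real.exp_neg, inv_inv]
  rw [this, mul_comm]
  congr 1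
  field_simp

/-! ### The midpoint series and the total error -/

/-- The infinite midpoint sum of the inversion integral equals the aliased distribution
function. -/
theorem hasSum_midpoint_cdfTransform (μ : Measure ℝ) [IsProbabilityMeasure μ] {a : ℝ} (ha : a ≠ 0)
    (hμ : Integrable (fun x ↦ Real.exp (-a * x)) μ)
    (hμ2 : Integrable (fun x ↦ Real.exp (-(2 * a) * x)) μ) {C b : ℝ} (hb : 1 < b)
    (hC : ∀ u, ‖cdfTransform μ a u‖ ≤ C * (1 + |u|) ^ (-b)) {h : ℝ} (hh : 0 < h) (x : ℝ) :
    HasSum (fun n : ℕ ↦ h * Real.exp (a * x) / Real.pi *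
        (cdfTransform μ a (midpointNode h n) * cexp (-(I * x * midpointNode h n))).re)
      (∑' k : ℤ, (-1) ^ k * (Real.exp (-(a * (k * (2 * Real.pi / h)))) *
        shiftedCdf μ a (x + k * (2 * Real.pi / h)))) := by
  obtain ⟨hs, hP⟩ := tsum_alternating_shiftedCdf μ ha hμ hμ2 hb hC hh x
  set z : ℕ → ℂ := fun n ↦ cdfTransform μ a (midpointNode h n) * cexp (-(I * x * midpointNode h n))
    with hz
  have hnode : ∀ n : ℕ, intNode h n = midpointNode h n := fun n ↦ by
    simp [intNode, midpointNode]
  have hnode' : ∀ n : ℕ, intNode h (-(n + 1)) = -midpointNode h n := fun n ↦ by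
    simp only [intNode, midpointNode]; push_cast; ring
  have hpos : ∀ n : ℕ, cdfTransform μ a (-intNode h n) * cexp (I * x * intNode h n) =
      (starRingEnd ℂ) (z n) := by
    intro n
    rw [hz, hnode, cdfTransform_neg, map_mul, ← Complex.exp_conj]
    simp
  have hneg : ∀ n : ℕ, cdfTransform μ a (-intNode h (-(n + 1))) *
      cexp (I * x * intNode h (-(n + 1))) = z n := by
    intro n
    rw [hnode', neg_neg, hz]
    simp
  have hnorm : ∀ n : ℤ, ‖cdfTransform μ a (-intNode h n) * cexp (I * x * intNode h n)‖ =
      ‖cdfTransform μ a (-intNode h n)‖ := by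
    intro n
    rw [norm_mul, norm_exp]
    simp
  have hsz : Summable fun n : ℤ ↦ cdfTransform μ a (-intNode h n) * cexp (I * x * intNode h n) :=
    Summable.of_norm (by simpa only [hnorm] using hs)
  have hsz2 : Summable z := by
    have := hsz.comp_injective (i := fun n : ℕ ↦ (-(n + 1) : ℤ)) fun m n hmn ↦ by simpa using hmn
    exact this.congr hneg
  have hsz1 : Summable fun n ↦ (starRingEnd ℂ) (z n) :=
    (hsz.comp_injective (i := fun n : ℕ ↦ (n : ℤ)) Nat.cast_injective).congr hpos
  have hsplit := tsum_of_nat_of_neg_add_one (f := fun n : ℤ ↦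
    cdfTransform μ a (-intNode h n) * cexp (I * x * intNode h n))
    (hsz1.congr fun n ↦ (hpos n).symm) (hsz2.congr fun n ↦ (hneg n).symm)
  simp_rw [hpos, hneg] at hsplit
  -- Nodes of index n and -(n+1) are opposite and carry conjugate terms; together they give twice a
  -- real part, which cancels the 2 in 2π.
  rw [hsplit, ← conj_tsum, add_comm, add_conj, ← ofReal_tsum] at hP
  have hP' : ∑' k : ℤ, (-1) ^ k * (Real.exp (-(a * (k * (2 * Real.pi / h)))) *
        shiftedCdf μ a (x + k * (2 * Real.pi / h))) =
      h * Real.exp (a * x) / Real.pi * (∑' n, z n).re := by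
    apply ofReal_injective
    rw [hP]
    push_cast
    field_simp
  rw [hP']
  exact (hasSum_re hsz2.hasSum).mul_left _

theorem abs_le_norm_sub_mul_I (a u : ℝ) : |u| ≤ ‖(a : ℂ) - u * I‖ := by
  simpa using abs_im_le_norm ((a : ℂ) - u * I)

theorem abs_le_norm_sub_mul_I' (a u : ℝ) : |a| ≤ ‖(a : ℂ) - u * I‖ := by
  simpa using abs_re_le_norm ((a : ℂ) - u * I)

/-- Division by a - iu gains one power of |u|, hence integrability for any ω > 0. Beyond V one has 1
+ |u| ≤ 2|u|, whence 2^{1+ω}; below V the transform is at most m/|a|. -/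
theorem exists_cdfTransform_bound (μ : Measure ℝ) {a B ω U : ℝ} (ha : a ≠ 0) (hB : 0 < B)
    (hω : 0 < ω)
    (hdecay : ∀ u : ℝ, u ≠ 0 → U ≤ |u| →
      ‖complexMGF id μ (-((a : ℂ) - u * I))‖ ≤ B * |u| ^ (-ω)) :
    ∃ C, ∀ u, ‖cdfTransform μ a u‖ ≤ C * (1 + |u|) ^ (-(1 + ω)) := by
  set m := mgf id μ (-a)
  have hm : 0 ≤ m := mgf_nonneg
  set V := max U 1
  have hV : 1 ≤ V := le_max_right _ _
  refine ⟨B * 2 ^ (1 + ω) + m / |a| * (1 + V) ^ (1 + ω), fun u ↦ ?_⟩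
  have ha' : 0 < |a| := abs_pos.2 ha
  rw [cdfTransform, norm_div, add_mul]
  rcases le_or_gt V |u| with h | h
  · have hu : 0 < |u| := by linarith
    have h1 : ‖complexMGF id μ (-((a : ℂ) - u * I))‖ / ‖(a : ℂ) - u * I‖ ≤
        B * |u| ^ (-ω) / |u| :=
      div_le_div₀ (by positivity) (hdecay u (abs_pos.1 hu) ((le_max_left _ _).trans h)) hu
        (abs_le_norm_sub_mul_I a u)
    have h2 : |u| ^ (-ω) / |u| ≤ 2 ^ (1 + ω) * (1 + |u|) ^ (-(1 + ω)) := by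
      rw [← Real.rpow_sub_one hu.ne', show -ω - 1 = -(1 + ω) by ring, Real.rpow_neg hu.le,
        Real.rpow_neg (by positivity), ← div_eq_mul_inv, le_div_iff₀ (by positivity),
        inv_mul_le_iff₀ (by positivity), ← Real.mul_rpow hu.le (by norm_num)]
      exact Real.rpow_le_rpow (by positivity) (by linarith) (by linarith)
    have h3 := mul_le_mul_of_nonneg_left h2 hB.le
    have h4 : 0 ≤ m / |a| * (1 + V) ^ (1 + ω) * (1 + |u|) ^ (-(1 + ω)) := by positivity
    rw [mul_div_assoc] at h1
    linarith
  · have h1 : ‖complexMGF id μ (-((a : ℂ) - u * I))‖ ≤ m := by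
      refine norm_complexMGF_le_mgf.trans_eq ?_
      simp [m]
    have h2 : ‖complexMGF id μ (-((a : ℂ) - u * I))‖ / ‖(a : ℂ) - u * I‖ ≤ m / |a| :=
      div_le_div₀ hm h1 ha' (abs_le_norm_sub_mul_I' a u)
    have h3 : 1 ≤ (1 + V) ^ (1 + ω) * (1 + |u|) ^ (-(1 + ω)) := by
      rw [Real.rpow_neg (by positivity), ← div_eq_mul_inv, one_le_div (by positivity)]
      exact Real.rpow_le_rpow (by positivity) (by linarith) (by linarith)
    have h4 : 0 ≤ B * 2 ^ (1 + ω) * (1 + |u|) ^ (-(1 + ω)) := by positivity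
    have h5 : m / |a| ≤ m / |a| * ((1 + V) ^ (1 + ω) * (1 + |u|) ^ (-(1 + ω))) :=
      le_mul_of_one_le_right (by positivity) h3
    rw [← mul_assoc] at h5
    linarith

/-- From e^{-t} ≤ 1/t. It supplies only the integrability of the transform; the constant B/l does
not reach the error bound. -/
theorem ExponentialDecay.powerLawDecay {φ : ℂ → ℂ} {a B l ω U : ℝ} (hB : 0 < B) (hl : 0 < l)
    (h : ExponentialDecay φ a B l ω U) : PowerLawDecay φ a (B / l) ω U := by
  intro u hu hU
  refine (h u hU).trans_le ?_
  have hu' : 0 < |u| := abs_pos.2 hu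
  have ht : 0 < l * |u| ^ ω := by positivity
  have h1 : Real.exp (-l * |u| ^ ω) ≤ (l * |u| ^ ω)⁻¹ := by
    rw [neg_mul, Real.exp_neg]
    exact inv_anti₀ ht (by linarith [Real.add_one_le_exp (l * |u| ^ ω)])
  rw [Real.rpow_neg hu'.le, div_mul_eq_mul_div, mul_div_assoc]
  refine mul_le_mul_of_nonneg_left (h1.trans_eq ?_) hB.le
  rw [mul_inv, div_eq_inv_mul]

/-- The error of the midpoint approximation, given a bound for the tail of the midpoint sum. -/
theorem abs_cdf_sub_cdfApprox_le (μ : Measure ℝ) [IsProbabilityMeasure μ] {φ : ℂ → ℂ} {a : ℝ}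
    (ha : a ≠ 0) (hμ : Integrable (fun x ↦ Real.exp (-a * x)) μ)
    (hμ2 : Integrable (fun x ↦ Real.exp (-(2 * a) * x)) μ)
    (hφ : ∀ u : ℝ, φ (u + I * a) = complexMGF id μ (-((a : ℂ) - u * I)))
    (hφ2 : φ (2 * I * a) = mgf id μ (-(2 * a))) {B ω U : ℝ} (hB : 0 < B) (hω : 0 < ω)
    (hdecay : PowerLawDecay φ a B ω U) {h : ℝ} (hh : 0 < h) (N : ℕ) {K : ℝ}
    (hK : ∀ m : ℕ, ∑ j ∈ Finset.range m, h * (‖φ (midpointNode h (N + j) + I * a)‖ /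
      midpointNode h (N + j)) ≤ K) (x : ℝ) :
    |cdf μ x - cdfApprox φ a h N x| ≤
      Real.exp (a * x) / Real.pi * K + discretisationBound φ a h x := by
  obtain ⟨C, hC⟩ := exists_cdfTransform_bound μ ha hB hω fun u hu hU ↦ by
    rw [← hφ]; exact (hdecay u hu hU).le
  have hsum := hasSum_midpoint_cdfTransform μ ha hμ hμ2 (by linarith : 1 < 1 + ω) hC hh x
  have halias := abs_tsum_alternating_shiftedCdf_sub_le μ ha hμ2
    (T := 2 * Real.pi / h) (by positivity) x
  set S := ∑' k : ℤ, (-1) ^ k * (Real.exp (-(a * (k * (2 * Real.pi / h)))) *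
    shiftedCdf μ a (x + k * (2 * Real.pi / h)))
  set r : ℕ → ℝ := fun n ↦ h * Real.exp (a * x) / Real.pi *
    (cdfTransform μ a (midpointNode h n) * cexp (-(I * x * midpointNode h n))).re with hr
  have happrox : cdfApprox φ a h N x = residueTerm a + ∑ n ∈ Finset.range N, r n := by
    -- Since i(u + ia) = -(a - iu), the minus sign in the inversion formula disappears.
    rw [cdfApprox, re_sum, sub_eq_add_neg, ← mul_neg, ← Finset.sum_neg_distrib, Finset.mul_sum]
    congr 1
    refine Finset.sum_congr rfl fun n _ ↦ ?_
    simp only [hr]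
    rw [← neg_re, hφ, cdfTransform]
    congr 2
    have : I * (midpointNode h n + I * a) = -((a : ℂ) - midpointNode h n * I) := by
      linear_combination (a : ℂ) * I_mul_I
    rw [this, div_neg, neg_mul, neg_neg]
  have hrle : ∀ j, ‖r (j + N)‖ ≤ Real.exp (a * x) / Real.pi *
      (h * (‖φ (midpointNode h (N + j) + I * a)‖ / midpointNode h (N + j))) := by
    intro j
    rw [add_comm j N]
    have hu : 0 < midpointNode h (N + j) := by unfold midpointNode; positivity
    have h1 : |(cdfTransform μ a (midpointNode h (N + j)) *
        cexp (-(I * x * midpointNode h (N + j)))).re| ≤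
        ‖φ (midpointNode h (N + j) + I * a)‖ / midpointNode h (N + j) := by
      refine (abs_re_le_norm _).trans ?_
      have h2 : ‖cexp (-(I * x * midpointNode h (N + j)))‖ = 1 := by
        rw [norm_exp]; simp
      rw [norm_mul, h2, mul_one, cdfTransform, norm_div, hφ]
      refine div_le_div_of_nonneg_left (norm_nonneg _) hu ?_
      exact (le_abs_self _).trans (abs_le_norm_sub_mul_I _ _)
    rw [hr, Real.norm_eq_abs, abs_mul, abs_of_pos (by positivity)]
    calc _ ≤ h * Real.exp (a * x) / Real.pi *
        (‖φ (midpointNode h (N + j) + I * a)‖ / midpointNode h (N + j)) := by gcongr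
      _ = _ := by ring
  have hg0 : ∀ j, 0 ≤ h * (‖φ (midpointNode h (N + j) + I * a)‖ / midpointNode h (N + j)) :=
    fun j ↦ by unfold midpointNode; positivity
  have hgs := summable_of_sum_range_le hg0 hK
  have htail : |∑' j, r (j + N)| ≤ Real.exp (a * x) / Real.pi * K := by
    refine (tsum_of_norm_bounded (hgs.mul_left _).hasSum hrle).trans ?_
    rw [tsum_mul_left]
    refine mul_le_mul_of_nonneg_left ?_ (by positivity)
    exact hgs.tsum_le_of_sum_range_le hK
  have hsplit := hsum.summable.sum_add_tsum_nat_add N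
  rw [hsum.tsum_eq] at hsplit
  have heq : cdf μ x - cdfApprox φ a h N x =
      ∑' j, r (j + N) - (S - shiftedCdf μ a x) := by
    rw [happrox, ← hsplit, shiftedCdf]
    ring
  have hdisc : discretisationBound φ a h x =
      1 / (Real.exp (|a| * (2 * Real.pi / h)) - Real.exp (-(|a| * (2 * Real.pi / h)))) *
        (1 + Real.exp (2 * a * x) * mgf id μ (-(2 * a))) := by
    rw [discretisationBound, hφ2, ofReal_re]
    ring_nf
  rw [heq, hdisc]
  exact (abs_sub _ _).trans (add_le_add htail halias)

/-- Both error bounds, for the law of the random variable. -/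
theorem IsCharFunOnStrip.abs_cdf_sub_cdfApprox_le {μ : Measure ℝ} [IsProbabilityMeasure μ]
    {pₗ pᵤ : EReal} {φ : ℂ → ℂ} (hφ : IsCharFunOnStrip μ pₗ pᵤ φ) (a : ℝ) (ha₀ : a ≠ 0)
    (ha_lo : pₗ / 2 < (a : EReal)) (ha_hi : (a : EReal) < pᵤ / 2) :
    (φ (2 * I * (a : ℂ))).im = 0 ∧
    (∀ B l ω U : ℝ, 0 < B → 0 < l → 0 < ω → ExponentialDecay φ a B l ω U →
      ∀ (N : ℕ) (h : ℝ), 0 < N → 0 < h → U ≤ N * h → ∀ x : ℝ,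
        |cdf μ x - cdfApprox φ a h N x| ≤
          B * Real.exp (a * x) / (Real.pi * ω) *
              (Real.exp (-l * (N * h) ^ ω) / (l * (N * h) ^ ω)) +
            discretisationBound φ a h x) ∧
    (∀ B ω U : ℝ, 0 < B → 0 < ω → PowerLawDecay φ a B ω U →
      ∀ (N : ℕ) (h : ℝ), 0 < N → 0 < h → U ≤ N * h → ∀ x : ℝ,
        |cdf μ x - cdfApprox φ a h N x| ≤
          B * Real.exp (a * x) / (Real.pi * ω) * (N * h) ^ (-ω) +
            discretisationBound φ a h x) := by
  have h2 : (0 : EReal) < 2 := by norm_num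
  have h2' : (2 : EReal) ≠ ⊤ := by exact_mod_cast EReal.coe_ne_top 2
  have hlo2 : pₗ < ((2 * a : ℝ) : EReal) := by
    rw [EReal.div_lt_iff h2 h2'] at ha_lo
    rw [mul_comm]; exact_mod_cast ha_lo
  have hhi2 : ((2 * a : ℝ) : EReal) < pᵤ := by
    rw [EReal.lt_div_iff h2 h2'] at ha_hi
    rw [mul_comm]; exact_mod_cast ha_hi
  -- a lies between 0 and 2a, both of which are in the strip.
  have hlo : pₗ < (a : EReal) := by
    rcases le_total 0 a with h | h
    · exact hφ.neg.trans_le (by exact_mod_cast h)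
    · exact hlo2.trans_le (by exact_mod_cast (by linarith : 2 * a ≤ a))
  have hhi : (a : EReal) < pᵤ := by
    rcases le_total 0 a with h | h
    · exact lt_of_le_of_lt (by exact_mod_cast (by linarith : a ≤ 2 * a)) hhi2
    · exact lt_of_le_of_lt (by exact_mod_cast h) hφ.pos
  obtain ⟨hμ, hφ1⟩ := hφ.eq_complexMGF hlo hhi
  obtain ⟨hμ2, hφ2⟩ := hφ.eq_complexMGF hlo2 hhi2
  have hline : ∀ u : ℝ, φ (u + I * a) = complexMGF id μ (-((a : ℂ) - u * I)) := by
    intro u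
    rw [hφ1]
    congr 1
    linear_combination (a : ℂ) * I_mul_I
  have hreal : φ (2 * I * a) = mgf id μ (-(2 * a)) := by
    rw [← complexMGF_ofReal]
    have := hφ2 0
    push_cast at this ⊢
    rw [zero_add, show I * (2 * a : ℂ) = 2 * I * a by ring] at this
    rw [this]
    congr 1
    linear_combination (2 * a : ℂ) * I_mul_I
  refine ⟨by rw [hreal, ofReal_im], fun B l ω U hB hl hω hdecay N h hN hh hNU x ↦ ?_,
    fun B ω U hB hω hdecay N h hN hh hNU x ↦ ?_⟩
  all_goals
    have hN' : (0 : ℝ) < N := by exact_mod_cast hN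
    have hnode : ∀ j, 0 < midpointNode h (N + j) := fun j ↦ by unfold midpointNode; positivity
    have hnodeU : ∀ j, U ≤ |midpointNode h (N + j)| := fun j ↦ by
      rw [abs_of_pos (hnode j)]
      refine hNU.trans ?_
      unfold midpointNode
      push_cast
      gcongr
      linarith [Nat.cast_nonneg (α := ℝ) j]
  · have hK : ∀ m : ℕ, ∑ j ∈ Finset.range m, h * (‖φ (midpointNode h (N + j) + I * a)‖ /
        midpointNode h (N + j)) ≤
        B * (Real.exp (-l * (N * h) ^ ω) / (ω * (l * (N * h) ^ ω))) := by
      intro m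
      have htail := (le_total ω 1).elim
        (fun h1 ↦ sum_midpoint_exp_le_of_le_one hl hω h1 hh hN m)
        (fun h1 ↦ sum_midpoint_exp_le_of_one_le hl h1 hh hN m)
      refine le_trans ?_ (mul_le_mul_of_nonneg_left htail hB.le)
      rw [Finset.mul_sum]
      refine Finset.sum_le_sum fun j _ ↦ ?_
      have h1 := (hdecay _ (hnodeU j)).le
      rw [abs_of_pos (hnode j)] at h1
      exact (mul_le_mul_of_nonneg_left (div_le_div_of_nonneg_right h1 (hnode j).le) hh.le).trans_eq
        (by ring)
    refine (_root_.abs_cdf_sub_cdfApprox_le μ ha₀ hμ hμ2 hline hreal (by positivity : 0 < B / l) hω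
      (hdecay.powerLawDecay hB hl) hh N hK x).trans_eq ?_
    congr 1
    field_simp
  · have hK : ∀ m : ℕ, ∑ j ∈ Finset.range m, h * (‖φ (midpointNode h (N + j) + I * a)‖ /
        midpointNode h (N + j)) ≤ B * ((N * h) ^ (-ω) / ω) := by
      intro m
      refine le_trans ?_ (mul_le_mul_of_nonneg_left (sum_midpoint_rpow_le hω hh hN m) hB.le)
      rw [Finset.mul_sum]
      refine Finset.sum_le_sum fun j _ ↦ ?_
      have h1 := (hdecay _ (hnode j).ne' (hnodeU j)).le
      rw [abs_of_pos (hnode j)] at h1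
      exact (mul_le_mul_of_nonneg_left (div_le_div_of_nonneg_right h1 (hnode j).le) hh.le).trans_eq
        (by ring)
    refine (_root_.abs_cdf_sub_cdfApprox_le μ ha₀ hμ hμ2 hline hreal hB hω hdecay hh N hK x).trans_eq ?_
    congr 1
    field_simp

end

theorem proposition4p1 {Ω : Type*} [MeasurableSpace Ω] (ℙ : Measure Ω) [IsProbabilityMeasure ℙ]
    (Z : Ω → ℝ) (hZ : AEMeasurable Z ℙ) (pₗ pᵤ : EReal) (φ : ℂ → ℂ)
    (hφ : IsCharFunOnStrip (ℙ.map Z) pₗ pᵤ φ)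
    (a : ℝ) (ha₀ : a ≠ 0) (ha_lo : pₗ / 2 < (a : EReal)) (ha_hi : (a : EReal) < pᵤ / 2) :
    (φ (2 * Complex.I * (a : ℂ))).im = 0 ∧
    (∀ B l ω U : ℝ, 0 < B → 0 < l → 0 < ω → ExponentialDecay φ a B l ω U →
      ∀ (N : ℕ) (h : ℝ), 0 < N → 0 < h → U ≤ N * h → ∀ x : ℝ,
        |ℙ.real {w | Z w ≤ x} - cdfApprox φ a h N x| ≤
          B * Real.exp (a * x) / (Real.pi * ω) *
              (Real.exp (-l * (N * h) ^ ω) / (l * (N * h) ^ ω)) +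
            discretisationBound φ a h x) ∧
    (∀ B ω U : ℝ, 0 < B → 0 < ω → PowerLawDecay φ a B ω U →
      ∀ (N : ℕ) (h : ℝ), 0 < N → 0 < h → U ≤ N * h → ∀ x : ℝ,
        |ℙ.real {w | Z w ≤ x} - cdfApprox φ a h N x| ≤
          B * Real.exp (a * x) / (Real.pi * ω) * (N * h) ^ (-ω) +
            discretisationBound φ a h x) := by
  have : IsProbabilityMeasure (ℙ.map Z) := Measure.isProbabilityMeasure_map hZ
  have hcdf : ∀ x, ℙ.real {w | Z w ≤ x} = ProbabilityTheory.cdf (ℙ.map Z) x := by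
    intro x
    rw [ProbabilityTheory.cdf_eq_real, measureReal_def, measureReal_def,
      Measure.map_apply_of_aemeasurable hZ measurableSet_Iic]
    rfl
  simp_rw [hcdf]
  exact hφ.abs_cdf_sub_cdfApprox_le a ha₀ ha_lo ha_hi
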